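/- Let $L>0$. Let $H=L^2_{\frac{dx}{L-x}}(0,L)$ be the real weighted Lebesgue space with norm $\|u\|_H=\|(L-x)^{-1/2}u\|_{L^2(0,L)}$, and let $$V=\{u\in H^2_0(0,L):\ (L-x)^{-1}u_{xx}\in L^2(0,L)\}\subset H,\qquad \|u\|_V=\|(L-x)^{-1}u_{xx}\|_{L^2(0,L)}.$$ For $\beta\in\mathbb R$ let $\mathcal A_\beta$ be the unbounded operator of $H$ given by $$\mathcal A_\beta u=u_{xxxxx}-\beta u_{xxx},\qquad D(\mathcal A_\beta)=\{u\in H^5(0,L)\cap H^2_0(0,L):\ u_{xx}(L)=0,\ u_{xxxxx}-\beta u_{xxx}\in H\}.$$ Then for every $\beta>-\frac{3}{80}$ the operator $\mathcal A_\beta$ is the infinitesimal generator of a strongly continuous semigroup $(e^{t\mathcal A_\beta})_{t\ge0}$ of bounded operators on $H$, and for every $T>0$ there is a constant $C=C(L,T)>0$ such that, for all $\beta>-\frac{3}{80}$ and all $u_0\in H$, the solution $u(t)=e^{t\mathcal A_\beta}u_0$ of $$u_t=u_{xxxxx}-\beta u_{xxx},\qquad u(t,0)=u(t,L)=u_x(t,0)=u_x(t,L)=u_{xx}(t,L)=0,\qquad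 u(0,\cdot)=u_0,$$ belongs to $L^\infty(0,T;H)\cap L^2(0,T;V)$ and satisfies $$\|u\|_{L^\infty(0,T;H)}+\|u\|_{L^2(0,T;V)}\le C\,\|u_0\|_H.$$ -/

import Mathlib

open MeasureTheory Set Filter Topology
open scoped ENNReal ContDiff

/-! ### Weighted Lebesgue spaces on `(0, L)` -/

/-- The measure `w(x) dx` on the open interval `(0, L)`. -/
noncomputable def weightedMeasure (L : ℝ) (w : ℝ → ℝ) : Measure ℝ :=
  (volume.restrict (Ioo 0 L)).withDensity (fun x => ENNReal.ofReal (w x))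

/-- The measure `dx / (L - x)` on `(0, L)`. -/
noncomputable def muH (L : ℝ) : Measure ℝ := weightedMeasure L (fun x => (L - x)⁻¹)

/-- The measure `dx / (L - x)²` on `(0, L)`. -/
noncomputable def muV (L : ℝ) : Measure ℝ := weightedMeasure L (fun x => ((L - x) ^ 2)⁻¹)

/-- The real Hilbert space `H = L²((0, L), dx / (L - x))`. -/
abbrev SpaceH (L : ℝ) : Type := Lp ℝ 2 (muH L)

/-! ### Weak derivatives, Sobolev spaces and boundary values on `(0, L)` -/

/-- `v` is the `k`-th weak derivative of `u` on `(0, L)`. -/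
def HasWeakDeriv (L : ℝ) (k : ℕ) (u v : ℝ → ℝ) : Prop :=
  LocallyIntegrableOn u (Ioo 0 L) ∧ LocallyIntegrableOn v (Ioo 0 L) ∧
    ∀ φ : ℝ → ℝ, ContDiff ℝ ∞ φ → HasCompactSupport φ → tsupport φ ⊆ Ioo 0 L →
      ∫ x in Ioo 0 L, u x * iteratedDeriv k φ x = (-1) ^ k * ∫ x in Ioo 0 L, v x * φ x

/-- `u ∈ H^m(0, L)`: the weak derivatives of `u` of order at most `m` exist and belong to
`L²(0, L)`. -/
def MemSobolev (L : ℝ) (m : ℕ) (u : ℝ → ℝ) : Prop :=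
  ∀ k ≤ m, ∃ v : ℝ → ℝ, HasWeakDeriv L k u v ∧ MemLp v 2 (volume.restrict (Ioo 0 L))

/-- `u` vanishes at the point `a ∈ [0, L]` in the sense of traces: `u` agrees almost everywhere
on `(0, L)` with a continuous function on `[0, L]` that vanishes at `a`. -/
def HasZeroTrace (L a : ℝ) (u : ℝ → ℝ) : Prop :=
  ∃ f : ℝ → ℝ, ContinuousOn f (Icc 0 L) ∧ f =ᵐ[volume.restrict (Ioo 0 L)] u ∧ f a = 0

/-- `u ∈ H²₀(0, L)`: `u ∈ H²(0, L)` and `u(0) = u(L) = u_x(0) = u_x(L) = 0`. -/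
def MemH20 (L : ℝ) (u : ℝ → ℝ) : Prop :=
  MemSobolev L 2 u ∧ HasZeroTrace L 0 u ∧ HasZeroTrace L L u ∧
    ∃ v : ℝ → ℝ, HasWeakDeriv L 1 u v ∧ HasZeroTrace L 0 v ∧ HasZeroTrace L L v

/-! ### The operator and the semigroup -/

/-- The graph of the unbounded operator `u ↦ u_xxxxx - β u_xxx` of `H`, with domain
`{u ∈ H⁵(0, L) ∩ H²₀(0, L) : u_xx(L) = 0, u_xxxxx - β u_xxx ∈ H}`:
`KawaharaGraph L β u f` says that `u` is in the domain and that the operator maps `u` to `f`. -/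
def KawaharaGraph (L β : ℝ) (u f : SpaceH L) : Prop :=
  MemSobolev L 5 u ∧ MemH20 L u ∧
    (∃ u₂ : ℝ → ℝ, HasWeakDeriv L 2 u u₂ ∧ HasZeroTrace L L u₂) ∧
    ∃ u₃ u₅ : ℝ → ℝ, HasWeakDeriv L 3 u u₃ ∧ HasWeakDeriv L 5 u u₅ ∧
      f =ᵐ[volume.restrict (Ioo 0 L)] fun x => u₅ x - β * u₃ x

/-- `(S t)_{t ≥ 0}` is a strongly continuous semigroup of bounded operators of `X`
(the values at negative times play no role). -/
structure IsC0Semigroup {X : Type*} [NormedAddCommGroup X] [NormedSpace ℝ X]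
    (S : ℝ → X →L[ℝ] X) : Prop where
  zero : S 0 = ContinuousLinearMap.id ℝ X
  add : ∀ s t : ℝ, 0 ≤ s → 0 ≤ t → S (s + t) = (S s).comp (S t)
  continuousOn : ∀ x : X, ContinuousOn (fun t => S t x) (Ici 0)

/-- `(S t)_{t ≥ 0}` is a strongly continuous semigroup whose infinitesimal generator is the
operator with graph `A`: the pairs `(x, y)` of the graph are exactly those
for which `(S h x - x) / h → y` as `h → 0⁺`. -/
def IsSemigroupGeneratedBy {X : Type*} [NormedAddCommGroup X] [NormedSpace ℝ X]
    (S : ℝ → X →L[ℝ] X) (A : X → X → Prop) : Prop :=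
  IsC0Semigroup S ∧
    ∀ x y : X, A x y ↔ Tendsto (fun h : ℝ => h⁻¹ • (S h x - x)) (𝓝[>] 0) (𝓝 y)

/-! ### Elementary facts on weak derivatives -/

theorem measurable_weight (L : ℝ) (n : ℕ) :
    Measurable fun x : ℝ => ENNReal.ofReal (((L - x) ^ n)⁻¹) := by
  fun_prop

theorem ae_weight_iff (L : ℝ) (n : ℕ) {p : ℝ → Prop} :
    (∀ᵐ x ∂(weightedMeasure L fun x => ((L - x) ^ n)⁻¹), p x) ↔
      ∀ᵐ x ∂(volume.restrict (Ioo 0 L)), p x := by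
  unfold weightedMeasure
  rw [ae_withDensity_iff (measurable_weight L n)]
  have hpos : ∀ᵐ x ∂(volume.restrict (Ioo 0 L)),
      ENNReal.ofReal (((L - x) ^ n)⁻¹) ≠ 0 := by
    filter_upwards [ae_restrict_mem measurableSet_Ioo] with x hx
    have : 0 < L - x := by linarith [hx.2]
    have : 0 < ((L - x) ^ n)⁻¹ := by positivity
    simpa using this
  constructor
  · intro h
    filter_upwards [h, hpos] with x h1 h2 using h1 h2
  · intro h
    filter_upwards [h] with x h1 _ using h1

theorem ae_muV_iff (L : ℝ) {p : ℝ → Prop} :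
    (∀ᵐ x ∂(muV L), p x) ↔ ∀ᵐ x ∂(volume.restrict (Ioo 0 L)), p x :=
  ae_weight_iff L 2

theorem ae_muH_iff (L : ℝ) {p : ℝ → Prop} :
    (∀ᵐ x ∂(muH L), p x) ↔ ∀ᵐ x ∂(volume.restrict (Ioo 0 L)), p x := by
  simpa [muH] using ae_weight_iff L 1 (p := p)

theorem ae_eq_muV_iff (L : ℝ) {f g : ℝ → ℝ} :
    f =ᵐ[muV L] g ↔ f =ᵐ[volume.restrict (Ioo 0 L)] g :=
  ae_muV_iff L

theorem ae_eq_muH_iff (L : ℝ) {f g : ℝ → ℝ} :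
    f =ᵐ[muH L] g ↔ f =ᵐ[volume.restrict (Ioo 0 L)] g :=
  ae_muH_iff L

theorem integrableOn_mul_test {L : ℝ} {u φ : ℝ → ℝ} (hu : LocallyIntegrableOn u (Ioo 0 L))
    (hφ : Continuous φ) (hc : HasCompactSupport φ) (hs : tsupport φ ⊆ Ioo 0 L) :
    IntegrableOn (fun x => u x * φ x) (Ioo 0 L) := by
  have hK : IntegrableOn u (tsupport φ) := hu.integrableOn_compact_subset hs hc
  have h1 : IntegrableOn (fun x => u x * φ x) (tsupport φ) :=
    hK.mul_continuousOn hφ.continuousOn hc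
  have h2 : Integrable (fun x => u x * φ x) := by
    rw [← integrableOn_iff_integrable_of_support_subset (s := tsupport φ)]
    · exact h1
    · intro x hx
      apply subset_tsupport
      simp only [Function.mem_support] at hx ⊢
      exact right_ne_zero_of_mul hx
  exact h2.integrableOn

theorem test_iteratedDeriv {L : ℝ} {φ : ℝ → ℝ} (k : ℕ) (h : ContDiff ℝ ∞ φ)
    (hc : HasCompactSupport φ) (hs : tsupport φ ⊆ Ioo 0 L) :
    ContDiff ℝ ∞ (iteratedDeriv k φ) ∧ HasCompactSupport (iteratedDeriv k φ) ∧
      tsupport (iteratedDeriv k φ) ⊆ Ioo 0 L := by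
  induction k with
  | zero => simpa using ⟨h, hc, hs⟩
  | succ k ih =>
    obtain ⟨h1, h2, h3⟩ := ih
    rw [iteratedDeriv_succ]
    refine ⟨?_, h2.deriv, (tsupport_deriv_subset (𝕜 := ℝ)).trans h3⟩
    exact ((contDiff_infty_iff_deriv (𝕜 := ℝ)).1 h1).2

theorem HasWeakDeriv.congr {L : ℝ} {k : ℕ} {u u' v : ℝ → ℝ} (h : HasWeakDeriv L k u v)
    (hu : u =ᵐ[volume.restrict (Ioo 0 L)] u') : HasWeakDeriv L k u' v := by
  refine ⟨?_, h.2.1, fun φ h1 h2 h3 => ?_⟩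
  · rw [locallyIntegrableOn_iff isOpen_Ioo.isLocallyClosed]
    intro K hK hKc
    have := h.1.integrableOn_compact_subset hK hKc
    exact this.congr (ae_restrict_of_ae_restrict_of_subset hK hu)
  · rw [← h.2.2 φ h1 h2 h3]
    refine integral_congr_ae ?_
    filter_upwards [hu] with x hx
    rw [hx]

theorem HasWeakDeriv.add {L : ℝ} {k : ℕ} {u u' v v' : ℝ → ℝ} (h : HasWeakDeriv L k u v)
    (h' : HasWeakDeriv L k u' v') : HasWeakDeriv L k (u + u') (v + v') := by
  refine ⟨h.1.add h'.1, h.2.1.add h'.2.1, fun φ h1 h2 h3 => ?_⟩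
  obtain ⟨d1, d2, d3⟩ := test_iteratedDeriv k h1 h2 h3
  simp only [Pi.add_apply, add_mul]
  rw [integral_add (integrableOn_mul_test h.1 d1.continuous d2 d3)
      (integrableOn_mul_test h'.1 d1.continuous d2 d3),
    integral_add (integrableOn_mul_test h.2.1 h1.continuous h2 h3)
      (integrableOn_mul_test h'.2.1 h1.continuous h2 h3),
    h.2.2 φ h1 h2 h3, h'.2.2 φ h1 h2 h3, mul_add]

theorem HasWeakDeriv.smul {L : ℝ} {k : ℕ} {u v : ℝ → ℝ} (c : ℝ) (h : HasWeakDeriv L k u v) :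
    HasWeakDeriv L k (c • u) (c • v) := by
  refine ⟨h.1.smul c, h.2.1.smul c, fun φ h1 h2 h3 => ?_⟩
  simp only [Pi.smul_apply, smul_eq_mul, mul_assoc]
  rw [integral_const_mul, integral_const_mul, h.2.2 φ h1 h2 h3]
  ring

theorem HasWeakDeriv.unique {L : ℝ} {k : ℕ} {u v v' : ℝ → ℝ} (h : HasWeakDeriv L k u v)
    (h' : HasWeakDeriv L k u v') : v =ᵐ[volume.restrict (Ioo 0 L)] v' := by
  have key : ∀ᵐ x, x ∈ Ioo 0 L → (v - v') x = 0 := by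
    refine isOpen_Ioo.ae_eq_zero_of_integral_contDiff_smul_eq_zero (h.2.1.sub h'.2.1) ?_
    intro φ h1 h2 h3
    have e : ∫ x in Ioo 0 L, v x * φ x = ∫ x in Ioo 0 L, v' x * φ x := by
      have := (h.2.2 φ h1 h2 h3).symm.trans (h'.2.2 φ h1 h2 h3)
      exact mul_left_cancel₀ (pow_ne_zero k (by norm_num)) this
    rw [← setIntegral_eq_integral_of_forall_compl_eq_zero (s := Ioo 0 L)]
    · have : ∀ x, φ x • (v - v') x = v x * φ x - v' x * φ x := by
        intro x; simp only [Pi.sub_apply, smul_eq_mul]; ring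
      simp only [this]
      rw [integral_sub (integrableOn_mul_test h.2.1 h1.continuous h2 h3)
        (integrableOn_mul_test h'.2.1 h1.continuous h2 h3), e, sub_self]
    · intro x hx
      have : φ x = 0 := image_eq_zero_of_notMem_tsupport fun hx' => hx (h3 hx')
      simp [this]
  have := (ae_restrict_iff' measurableSet_Ioo).2 key
  filter_upwards [this] with x hx
  simpa [sub_eq_zero] using hx

theorem HasZeroTrace.add {L a : ℝ} {u v : ℝ → ℝ} (h : HasZeroTrace L a u)
    (h' : HasZeroTrace L a v) : HasZeroTrace L a (u + v) := by
  obtain ⟨f, hf, hfu, hfa⟩ := h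
  obtain ⟨g, hg, hgv, hga⟩ := h'
  exact ⟨f + g, hf.add hg, hfu.add hgv, by simp [hfa, hga]⟩

theorem HasZeroTrace.smul {L a : ℝ} {u : ℝ → ℝ} (c : ℝ) (h : HasZeroTrace L a u) :
    HasZeroTrace L a (c • u) := by
  obtain ⟨f, hf, hfu, hfa⟩ := h
  exact ⟨c • f, hf.const_smul c, hfu.const_smul c, by simp [hfa]⟩

theorem HasZeroTrace.congr {L a : ℝ} {u u' : ℝ → ℝ} (h : HasZeroTrace L a u)
    (hu : u =ᵐ[volume.restrict (Ioo 0 L)] u') : HasZeroTrace L a u' := by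
  obtain ⟨f, hf, hfu, hfa⟩ := h
  exact ⟨f, hf, hfu.trans hu, hfa⟩

theorem MemH20.add {L : ℝ} {u u' : ℝ → ℝ} (h : MemH20 L u) (h' : MemH20 L u') :
    MemH20 L (u + u') := by
  obtain ⟨h1, h2, h3, v, h4, h5, h6⟩ := h
  obtain ⟨h1', h2', h3', v', h4', h5', h6'⟩ := h'
  refine ⟨fun k hk => ?_, h2.add h2', h3.add h3', v + v', h4.add h4', h5.add h5', h6.add h6'⟩
  obtain ⟨z, a, b⟩ := h1 k hk
  obtain ⟨z', a', b'⟩ := h1' k hk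
  exact ⟨z + z', a.add a', b.add b'⟩

theorem MemH20.smul {L : ℝ} {u : ℝ → ℝ} (c : ℝ) (h : MemH20 L u) : MemH20 L (c • u) := by
  obtain ⟨h1, h2, h3, v, h4, h5, h6⟩ := h
  refine ⟨fun k hk => ?_, h2.smul c, h3.smul c, c • v, h4.smul c, h5.smul c, h6.smul c⟩
  obtain ⟨z, a, b⟩ := h1 k hk
  exact ⟨c • z, a.smul c, b.const_smul c⟩

theorem MemH20.congr {L : ℝ} {u u' : ℝ → ℝ} (h : MemH20 L u)
    (hu : u =ᵐ[volume.restrict (Ioo 0 L)] u') : MemH20 L u' := by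
  obtain ⟨h1, h2, h3, v, h4, h5, h6⟩ := h
  refine ⟨fun k hk => ?_, h2.congr hu, h3.congr hu, v, h4.congr hu, h5, h6⟩
  obtain ⟨z, a, b⟩ := h1 k hk
  exact ⟨z, a.congr hu, b⟩

/-- A compactly supported smooth function with zero integral is the derivative of a
compactly supported smooth function. -/
theorem exists_test_primitive {L : ℝ} {φ : ℝ → ℝ} (h1 : ContDiff ℝ ∞ φ)
    (h2 : HasCompactSupport φ) (h3 : tsupport φ ⊆ Ioo 0 L) (h0 : ∫ x in Ioo 0 L, φ x = 0) :
    ∃ ψ : ℝ → ℝ, ContDiff ℝ ∞ ψ ∧ HasCompactSupport ψ ∧ tsupport ψ ⊆ Ioo 0 L ∧ deriv ψ = φ := by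
  rcases (tsupport φ).eq_empty_or_nonempty with he | hne
  · have : φ = 0 := tsupport_eq_empty_iff.1 he
    refine ⟨0, contDiff_const, HasCompactSupport.zero, by simp [tsupport], ?_⟩
    rw [this]; ext x; simp
  obtain ⟨a, ha, hamin⟩ := IsCompact.exists_isLeast h2 hne
  obtain ⟨b, hb, hbmax⟩ := IsCompact.exists_isGreatest h2 hne
  have hz : ∀ x, x ∉ Icc a b → φ x = 0 := fun x hx =>
    image_eq_zero_of_notMem_tsupport fun hx' => hx ⟨hamin hx', hbmax hx'⟩
  have hab : a ≤ b := hamin hb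
  have ha0 := h3 ha
  have hb0 := h3 hb
  let ψ : ℝ → ℝ := fun x => ∫ t in (0 : ℝ)..x, φ t
  have hder : ∀ x, HasDerivAt ψ (φ x) x := fun x =>
    intervalIntegral.integral_hasDerivAt_right (h1.continuous.intervalIntegrable _ _)
      (h1.continuous.stronglyMeasurableAtFilter _ _) h1.continuous.continuousAt
  have hderiv : deriv ψ = φ := funext fun x => (hder x).deriv
  have hsupp : ∀ x, x ∉ Icc a b → ψ x = 0 := by
    intro x hx
    have hx' : x < a ∨ b < x := by
      by_contra! hcon
      exact hx hcon
    rcases hx' with hx' | hx'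
    · refine intervalIntegral.integral_zero_ae (Eventually.of_forall fun t ht => hz t fun ht' => ?_)
      have : t ≤ max 0 x := (Set.mem_uIoc.1 ht).elim (fun h => h.2.trans (le_max_right _ _))
        (fun h => h.2.trans (le_max_left _ _))
      have : t < a := this.trans_lt (max_lt ha0.1 hx')
      exact absurd ht'.1 (not_le.2 this)
    · have e1 : ψ x = ψ L + ∫ t in L..x, φ t :=
        (intervalIntegral.integral_add_adjacent_intervals
          (h1.continuous.intervalIntegrable _ _) (h1.continuous.intervalIntegrable _ _)).symm
      have e2 : ∫ t in L..x, φ t = 0 := by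
        refine intervalIntegral.integral_zero_ae
          (Eventually.of_forall fun t ht => hz t fun ht' => ?_)
        have : min L x < t := (Set.mem_uIoc.1 ht).elim (fun h => (min_le_left _ _).trans_lt h.1)
          (fun h => (min_le_right _ _).trans_lt h.1)
        have : b < t := (lt_min hb0.2 hx').trans this
        exact absurd ht'.2 (not_le.2 this)
      have e3 : ψ L = 0 := by
        change ∫ t in (0 : ℝ)..L, φ t = 0
        rw [intervalIntegral.integral_of_le (ha0.1.trans ha0.2).le,
          integral_Ioc_eq_integral_Ioo, h0]
      rw [e1, e2, e3, add_zero]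
  have hts : tsupport ψ ⊆ Icc a b :=
    closure_minimal (fun x hx => by
      by_contra hcon
      exact hx (hsupp x hcon)) isClosed_Icc
  refine ⟨ψ, ?_, HasCompactSupport.of_support_subset_isCompact isCompact_Icc
    ((subset_tsupport ψ).trans hts), hts.trans fun x hx => ⟨ha0.1.trans_le hx.1,
      hx.2.trans_lt hb0.2⟩, hderiv⟩
  rw [contDiff_infty_iff_deriv]
  exact ⟨fun x => (hder x).differentiableAt, hderiv ▸ h1⟩

/-- A function with a vanishing weak derivative is constant. -/
theorem HasWeakDeriv.ae_const {L : ℝ} (hL : 0 < L) {v : ℝ → ℝ} (h : HasWeakDeriv L 1 v 0) :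
    ∃ c : ℝ, v =ᵐ[volume.restrict (Ioo 0 L)] fun _ => c := by
  obtain ⟨ρ, hρ1, hρ2, hρ3, hρ4⟩ : ∃ ρ : ℝ → ℝ, ContDiff ℝ ∞ ρ ∧ HasCompactSupport ρ ∧
      tsupport ρ ⊆ Ioo 0 L ∧ ∫ x in Ioo 0 L, ρ x = 1 := by
    let B : ContDiffBump (L / 2) := ⟨L / 8, L / 4, by positivity, by linarith⟩
    have hsub : tsupport (B.normed volume) ⊆ Ioo 0 L := by
      rw [B.tsupport_normed_eq]
      intro x hx
      rw [Metric.mem_closedBall, Real.dist_eq, abs_le] at hx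
      have : B.rOut = L / 4 := rfl
      constructor <;> linarith [hx.1, hx.2]
    refine ⟨B.normed volume, B.contDiff_normed, B.hasCompactSupport_normed, hsub, ?_⟩
    rw [setIntegral_eq_integral_of_forall_compl_eq_zero, B.integral_normed]
    intro x hx
    exact image_eq_zero_of_notMem_tsupport fun hx' => hx (hsub hx')
  refine ⟨∫ x in Ioo 0 L, v x * ρ x, ?_⟩
  set c := ∫ x in Ioo 0 L, v x * ρ x with hc
  have hone : LocallyIntegrableOn (fun _ : ℝ => (1 : ℝ)) (Ioo 0 L) :=
    (locallyIntegrable_const 1).locallyIntegrableOn _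
  have hcst : LocallyIntegrableOn (fun _ : ℝ => c) (Ioo 0 L) :=
    (locallyIntegrable_const c).locallyIntegrableOn _
  refine HasWeakDeriv.unique (k := 0) (u := v) ⟨h.1, h.1, fun φ _ _ _ => by simp⟩
    ⟨h.1, hcst, fun φ h1 h2 h3 => ?_⟩
  simp only [iteratedDeriv_zero, pow_zero, one_mul]
  set m := ∫ x in Ioo 0 L, φ x with hm
  have hφi : IntegrableOn φ (Ioo 0 L) := by
    simpa using integrableOn_mul_test hone h1.continuous h2 h3
  have hρi : IntegrableOn ρ (Ioo 0 L) := by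
    simpa using integrableOn_mul_test hone hρ1.continuous hρ2 hρ3
  have hsub : tsupport (fun x => φ x - m * ρ x) ⊆ Ioo 0 L := by
    refine (closure_minimal (t := tsupport φ ∪ tsupport ρ) (fun x hx => ?_)
      ((isClosed_tsupport φ).union (isClosed_tsupport ρ))).trans (union_subset h3 hρ3)
    by_contra hcon
    rw [mem_union, not_or] at hcon
    exact hx (by
      simp [image_eq_zero_of_notMem_tsupport hcon.1, image_eq_zero_of_notMem_tsupport hcon.2])
  obtain ⟨ψ, p1, p2, p3, p4⟩ := exists_test_primitive (L := L) (φ := fun x => φ x - m * ρ x)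
    (h1.sub (contDiff_const.mul hρ1)) (h2.sub hρ2.mul_left) hsub (by
      rw [integral_sub hφi (hρi.const_mul m), integral_const_mul, hρ4]; simp [hm])
  have := h.2.2 ψ p1 p2 p3
  rw [iteratedDeriv_one, p4] at this
  simp only [mul_sub, Pi.zero_apply, zero_mul, integral_zero, mul_zero] at this
  rw [integral_sub (integrableOn_mul_test h.1 h1.continuous h2 h3)] at this
  · have e : ∀ x, v x * (m * ρ x) = m * (v x * ρ x) := fun x => by ring
    simp only [e] at this
    rw [integral_const_mul, ← hc] at this
    rw [integral_const_mul, ← hm]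
    linarith
  · have e : ∀ x, v x * (m * ρ x) = m * (v x * ρ x) := fun x => by ring
    simp only [e]
    exact (integrableOn_mul_test h.1 hρ1.continuous hρ2 hρ3).const_mul m

/-- A constant that vanishes at the left end point in the sense of traces is zero. -/
theorem HasZeroTrace.const_eq_zero {L : ℝ} (hL : 0 < L) {c : ℝ} {u : ℝ → ℝ}
    (hu : u =ᵐ[volume.restrict (Ioo 0 L)] fun _ => c) (h : HasZeroTrace L 0 u) : c = 0 := by
  obtain ⟨f, hf, hfu, hfa⟩ := h
  have hEq : EqOn f (fun _ => c) (Icc 0 L) := by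
    have h1 : EqOn f (fun _ => c) (Ioo 0 L) :=
      Measure.eqOn_open_of_ae_eq (hfu.trans hu) isOpen_Ioo (hf.mono Ioo_subset_Icc_self)
        continuousOn_const
    refine h1.of_subset_closure hf continuousOn_const Ioo_subset_Icc_self ?_
    rw [closure_Ioo hL.ne]
  rw [← hfa, hEq ⟨le_rfl, hL.le⟩]

theorem MemH20.ae_eq_zero {L : ℝ} {u : ℝ → ℝ} (h : MemH20 L u)
    (h2 : HasWeakDeriv L 2 u 0) : u =ᵐ[volume.restrict (Ioo 0 L)] 0 := by
  rcases le_or_gt L 0 with hL | hL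
  · rw [Ioo_eq_empty (not_lt.2 hL), Measure.restrict_empty, EventuallyEq, ae_zero]
    exact eventually_bot
  obtain ⟨-, hu0, -, v, hv, hv0, -⟩ := h
  have hv' : HasWeakDeriv L 1 v 0 := by
    refine ⟨hv.2.1, h2.2.1, fun φ h1 hc hs => ?_⟩
    obtain ⟨d1, d2, d3⟩ := test_iteratedDeriv 1 h1 hc hs
    have e1 := hv.2.2 _ d1 d2 d3
    have e2 := h2.2.2 φ h1 hc hs
    have e3 : iteratedDeriv 1 (iteratedDeriv 1 φ) = iteratedDeriv 2 φ := by
      rw [iteratedDeriv_one, iteratedDeriv_one, iteratedDeriv_succ, iteratedDeriv_one]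
    rw [e3, e2] at e1
    simp only [Pi.zero_apply, zero_mul, integral_zero, mul_zero] at e1 ⊢
    linarith
  obtain ⟨c, hc⟩ := hv'.ae_const hL
  have hc0 := hv0.const_eq_zero hL hc
  have hu' : HasWeakDeriv L 1 u 0 := by
    refine ⟨hv.1, h2.2.1, fun φ h1 hcs hs => ?_⟩
    rw [hv.2.2 φ h1 hcs hs]
    congr 1
    refine integral_congr_ae ?_
    filter_upwards [hc] with x hx
    rw [hx, hc0]; rfl
  obtain ⟨d, hd⟩ := hu'.ae_const hL
  have hd0 := hu0.const_eq_zero hL hd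
  filter_upwards [hd] with x hx
  rw [hx, hd0]; rfl

/-! ### The space `V` -/

/-- The linear subspace `{u ∈ H²₀(0, L) : u_xx ∈ L²((0, L), dx / (L - x)²)}` of `H`. -/
def submoduleV (L : ℝ) : Submodule ℝ (SpaceH L) where
  carrier := {u | MemH20 L u ∧ ∃ z : ℝ → ℝ, HasWeakDeriv L 2 u z ∧ MemLp z 2 (muV L)}
  add_mem' := by
    rintro u v ⟨hu, z, hz, hz'⟩ ⟨hv, w, hw, hw'⟩
    have e : (u : ℝ → ℝ) + (v : ℝ → ℝ) =ᵐ[volume.restrict (Ioo 0 L)] (u + v : SpaceH L) :=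
      ((ae_eq_muH_iff L).1 (Lp.coeFn_add u v)).symm
    exact ⟨(hu.add hv).congr e, z + w, (hz.add hw).congr e, hz'.add hw'⟩
  zero_mem' := by
    have e : (0 : ℝ → ℝ) =ᵐ[volume.restrict (Ioo 0 L)] (0 : SpaceH L) :=
      ((ae_eq_muH_iff L).1 (Lp.coeFn_zero ℝ 2 (muH L))).symm
    have hi : LocallyIntegrableOn (0 : ℝ → ℝ) (Ioo 0 L) := locallyIntegrableOn_zero
    have hd : ∀ k, HasWeakDeriv L k 0 0 := fun k => ⟨hi, hi, fun φ _ _ _ => by simp⟩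
    have ht : ∀ a, HasZeroTrace L a 0 := fun a => ⟨0, continuousOn_const, ae_eq_rfl, rfl⟩
    have hH : MemH20 L 0 := ⟨fun k _ => ⟨0, hd k, MemLp.zero⟩, ht 0, ht L, 0, hd 1, ht 0, ht L⟩
    exact ⟨hH.congr e, 0, (hd 2).congr e, MemLp.zero⟩
  smul_mem' := by
    rintro c u ⟨hu, z, hz, hz'⟩
    have e : c • (u : ℝ → ℝ) =ᵐ[volume.restrict (Ioo 0 L)] (c • u : SpaceH L) :=
      ((ae_eq_muH_iff L).1 (Lp.coeFn_smul c u)).symm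
    exact ⟨(hu.smul c).congr e, c • z, (hz.smul c).congr e, hz'.const_smul c⟩

/-- The space `V`, as a type of its own, because its norm is not the one of `H`. -/
def SpaceV (L : ℝ) : Type := submoduleV L

noncomputable instance (L : ℝ) : AddCommGroup (SpaceV L) :=
  inferInstanceAs (AddCommGroup (submoduleV L))

noncomputable instance (L : ℝ) : Module ℝ (SpaceV L) :=
  inferInstanceAs (Module ℝ (submoduleV L))

/-- The inclusion of `V` in `H`. -/
noncomputable def SpaceV.toH {L : ℝ} : SpaceV L →ₗ[ℝ] SpaceH L := (submoduleV L).subtype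

/-- The map `u ↦ u_xx` from `V` to `L²((0, L), dx / (L - x)²)`. -/
noncomputable def SpaceV.dxx {L : ℝ} : SpaceV L →ₗ[ℝ] Lp ℝ 2 (muV L) where
  toFun u := (Classical.choose_spec u.2.2).2.toLp
  map_add' u v := by
    rw [← MemLp.toLp_add]
    refine MemLp.toLp_congr _ _ ((ae_eq_muV_iff L).2 ?_)
    have e : ((toH u : SpaceH L) : ℝ → ℝ) + ((toH v : SpaceH L) : ℝ → ℝ) =ᵐ[volume.restrict (Ioo 0 L)]
        (toH (u + v) : SpaceH L) := by
      rw [map_add]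
      exact ((ae_eq_muH_iff L).1 (Lp.coeFn_add (toH u) (toH v))).symm
    exact (Classical.choose_spec (u + v).2.2).1.unique
      (((Classical.choose_spec u.2.2).1.add (Classical.choose_spec v.2.2).1).congr e)
  map_smul' c u := by
    rw [RingHom.id_apply, ← MemLp.toLp_const_smul]
    refine MemLp.toLp_congr _ _ ((ae_eq_muV_iff L).2 ?_)
    have e : c • ((toH u : SpaceH L) : ℝ → ℝ) =ᵐ[volume.restrict (Ioo 0 L)]
        (toH (c • u) : SpaceH L) := by
      rw [map_smul]
      exact ((ae_eq_muH_iff L).1 (Lp.coeFn_smul c (toH u))).symm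
    exact (Classical.choose_spec (c • u).2.2).1.unique
      (((Classical.choose_spec u.2.2).1.smul c).congr e)

/-- `SpaceV.dxx u` is the second weak derivative of `u`. -/
theorem SpaceV.hasWeakDeriv_dxx {L : ℝ} (u : SpaceV L) :
    ∃ z : ℝ → ℝ, HasWeakDeriv L 2 (toH u) z ∧ dxx u =ᵐ[volume.restrict (Ioo 0 L)] z :=
  ⟨_, (Classical.choose_spec u.2.2).1,
    (ae_eq_muV_iff L).1 (MemLp.coeFn_toLp (Classical.choose_spec u.2.2).2)⟩

theorem SpaceV.dxx_injective {L : ℝ} : Function.Injective (dxx : SpaceV L →ₗ[ℝ] _) := by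
  rw [injective_iff_map_eq_zero]
  intro u hu
  obtain ⟨z, hz, hz'⟩ := hasWeakDeriv_dxx u
  have h0 : z =ᵐ[volume.restrict (Ioo 0 L)] 0 := by
    rw [hu] at hz'
    exact hz'.symm.trans ((ae_eq_muV_iff L).1 (Lp.coeFn_zero ℝ 2 (muV L)))
  have hz0 : HasWeakDeriv L 2 (toH u) 0 := by
    refine ⟨hz.1, locallyIntegrableOn_zero, fun φ h1 h2 h3 => ?_⟩
    rw [hz.2.2 φ h1 h2 h3]
    congr 1
    refine integral_congr_ae ?_
    filter_upwards [h0] with x hx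
    rw [hx]
  have := MemH20.ae_eq_zero u.2.1 hz0
  have hH : toH u = 0 := Lp.ext (((ae_eq_muH_iff L).2 this).trans (Lp.coeFn_zero ℝ 2 (muH L)).symm)
  exact Subtype.ext hH

/-- The norm of `V` is `‖u‖_V = ‖u_xx / (L - x)‖_{L²(0, L)}`. -/
noncomputable instance (L : ℝ) : NormedAddCommGroup (SpaceV L) :=
  NormedAddCommGroup.induced (SpaceV L) (Lp ℝ 2 (muV L)) SpaceV.dxx SpaceV.dxx_injective

noncomputable instance (L : ℝ) : NormedSpace ℝ (SpaceV L) :=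
  NormedSpace.induced ℝ (SpaceV L) (Lp ℝ 2 (muV L)) SpaceV.dxx

/-! Everything rests on one inequality: for `u` in the domain, `⟨A_β u, u⟩_H + (1/20) ‖u‖_V² ≤
(1/10) ‖u‖_H²`, with constants free of `β` (`KawaharaGraph.energy`). Write `w = (L - x)⁻¹`, so that
`w' = w²`. Multiplying `u_xxxxx` by `u w` and integrating by parts gives `-(5/2)∫ u_xx² w² + 15 ∫
u_x² w⁴ - 60 ∫ u² w⁶`. The last two terms can be absorbed exactly: modulo total derivatives the
negative of this form is `(1/10) u_xx² w²` plus `12/5` times a perfect square. The `β` term is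
nonnegative for `β ≥ 0` by a weighted Hardy inequality. For small negative `β` it is absorbed by the
remaining `1/10` and by `‖u‖_H²`. All Hardy inequalities enter as completed squares plus derivatives
of null terms, so the argument is a pointwise polynomial inequality (`exists_energyFluxDeriv_ge`)
followed by the fundamental theorem of calculus. The conditions `u = u_x = u_xx = 0` at `L` force
vanishing to orders 3, 2, 1, which makes the flux tend to zero at the singular end
(`exists_energyFlux_le`). At `0` it leaves a term of favourable sign.

Generation follows from maximal dissipativity. The equation `l u - A_β u = f` is a linear ODE of
order five with five boundary conditions. For `l > 1/10` the inequality gives uniqueness, hence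
injectivity of a linear map of `ℝ⁵` (`boundaryMap_injective`), hence solvability
(`exists_kawaharaGraph`). No adjoint is needed: in a Hilbert space, dissipativity and surjectivity
of `l - A` already imply that the domain is dense. Yosida approximation then produces the semigroup
(`IsMaximalDissipative.exists_semigroup`).

For data in the domain, integrating the inequality in time bounds both `‖u(t)‖_H` and the
`L²(0,T;V)` norm by `‖u₀‖_H`. By linearity the same bound applies to differences, so for general
data the approximating orbits are Cauchy in `L²(0,T;V)` (`exists_memLp_lift`). The passage to the
limit uses that `V` is complete (`SpaceV.completeSpace`) and embeds continuously in `H`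
(`SpaceV.exists_norm_toH_le`). -/

/-! ### Primitives and weak derivatives -/

/-- `f` is a primitive of the locally integrable function `g`. -/
def IsPrimitive (f g : ℝ → ℝ) : Prop :=
  LocallyIntegrable g ∧ ∀ x, f x = f 0 + ∫ t in (0 : ℝ)..x, g t

theorem MeasureTheory.LocallyIntegrable.intervalIntegrable {g : ℝ → ℝ} (hg : LocallyIntegrable g)
    (a b : ℝ) : IntervalIntegrable g volume a b :=
  (hg.integrableOn_isCompact isCompact_uIcc).intervalIntegrable

theorem isPrimitive_integral {g : ℝ → ℝ} (hg : LocallyIntegrable g) (c : ℝ) :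
    IsPrimitive (fun x => c + ∫ t in (0 : ℝ)..x, g t) g :=
  ⟨hg, fun x => by simp⟩

namespace IsPrimitive

variable {f g : ℝ → ℝ}

theorem ae_hasDerivAt (h : IsPrimitive f g) : ∀ᵐ x, HasDerivAt f (g x) x := by
  filter_upwards [LocallyIntegrable.ae_hasDerivAt_integral h.1] with x hx
  have := (hx 0).const_add (f 0)
  rwa [← show f = fun x => f 0 + ∫ t in (0 : ℝ)..x, g t from funext h.2] at this

theorem hasDerivAt (h : IsPrimitive f g) (hg : Continuous g) (x : ℝ) : HasDerivAt f (g x) x := by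
  have := (intervalIntegral.integral_hasDerivAt_right (hg.intervalIntegrable 0 x)
    (hg.stronglyMeasurableAtFilter _ _) hg.continuousAt).const_add (f 0)
  rwa [← show f = fun x => f 0 + ∫ t in (0 : ℝ)..x, g t from funext h.2] at this

theorem absolutelyContinuous (h : IsPrimitive f g) (a b : ℝ) :
    AbsolutelyContinuousOnInterval f a b := by
  have h0 : AbsolutelyContinuousOnInterval (fun _ : ℝ => f a) a b :=
    (LipschitzWith.const (f a)).lipschitzOnWith.absolutelyContinuousOnInterval
  have h1 := h0.add ((h.1.intervalIntegrable a b).absolutelyContinuousOnInterval_intervalIntegral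
    (c := a) (by simp))
  convert! h1 using 1
  funext x
  simp only [Pi.add_apply]
  rw [h.2 x, h.2 a, add_assoc, intervalIntegral.integral_add_adjacent_intervals
    (h.1.intervalIntegrable 0 a) (h.1.intervalIntegrable a x)]

theorem continuous (h : IsPrimitive f g) : Continuous f := by
  refine continuous_iff_continuousAt.2 fun x => ?_
  have := (h.absolutelyContinuous (x - 1) (x + 1)).continuousOn
  rw [uIcc_of_le (by linarith)] at this
  exact this.continuousAt (Icc_mem_nhds (by linarith) (by linarith))

/-- Integration by parts for absolutely continuous functions; the boundary terms vanish because a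
test function is zero at `0` and `L`. -/
theorem hasWeakDeriv (h : IsPrimitive f g) (L : ℝ) : HasWeakDeriv L 1 f g := by
  refine ⟨h.continuous.locallyIntegrable.locallyIntegrableOn _, h.1.locallyIntegrableOn _,
    fun φ h1 h2 h3 => ?_⟩
  rcases le_or_gt L 0 with hL | hL
  · simp [Ioo_eq_empty (not_lt.2 hL)]
  have hφ : AbsolutelyContinuousOnInterval φ 0 L :=
    (h1.of_le (by norm_cast)).contDiffOn.absolutelyContinuousOnInterval
  have key := (h.absolutelyContinuous 0 L).integral_mul_deriv_eq_deriv_mul hφ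
  have z0 : φ 0 = 0 := image_eq_zero_of_notMem_tsupport fun hx => (h3 hx).1.false
  have zL : φ L = 0 := image_eq_zero_of_notMem_tsupport fun hx => (h3 hx).2.false
  rw [z0, zL, intervalIntegral.integral_of_le hL.le, intervalIntegral.integral_of_le hL.le,
    integral_Ioc_eq_integral_Ioo, integral_Ioc_eq_integral_Ioo] at key
  have e : ∫ x in Ioo 0 L, deriv f x * φ x = ∫ x in Ioo 0 L, g x * φ x := by
    refine integral_congr_ae (ae_restrict_of_ae ?_)
    filter_upwards [h.ae_hasDerivAt] with x hx
    rw [hx.deriv]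
  rw [iteratedDeriv_one, key, e]
  ring

end IsPrimitive

theorem HasWeakDeriv.congr_right {L : ℝ} {k : ℕ} {u v v' : ℝ → ℝ} (h : HasWeakDeriv L k u v)
    (hv : v =ᵐ[volume.restrict (Ioo 0 L)] v') : HasWeakDeriv L k u v' := by
  refine ⟨h.1, ?_, fun φ h1 h2 h3 => ?_⟩
  · rw [locallyIntegrableOn_iff isOpen_Ioo.isLocallyClosed]
    intro K hK hKc
    exact (h.2.1.integrableOn_compact_subset hK hKc).congr
      (ae_restrict_of_ae_restrict_of_subset hK hv)
  · rw [h.2.2 φ h1 h2 h3]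
    congr 1
    refine integral_congr_ae ?_
    filter_upwards [hv] with x hx
    rw [hx]

theorem iteratedDeriv_iteratedDeriv_one (k : ℕ) (φ : ℝ → ℝ) :
    iteratedDeriv k (iteratedDeriv 1 φ) = iteratedDeriv (k + 1) φ := by
  rw [iteratedDeriv_one, ← iteratedDeriv_succ']

theorem HasWeakDeriv.succ {L : ℝ} {k : ℕ} {u v w : ℝ → ℝ} (h : HasWeakDeriv L k u v)
    (h' : HasWeakDeriv L 1 v w) : HasWeakDeriv L (k + 1) u w := by
  refine ⟨h.1, h'.2.1, fun φ h1 h2 h3 => ?_⟩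
  obtain ⟨d1, d2, d3⟩ := test_iteratedDeriv 1 h1 h2 h3
  have e1 := h.2.2 _ d1 d2 d3
  have e2 := h'.2.2 φ h1 h2 h3
  rw [iteratedDeriv_iteratedDeriv_one] at e1
  rw [e1, e2]
  ring

/-- Sobolev membership provides each weak derivative of `u` separately. Testing the one of order `k`
against `φ'` links consecutive derivatives, which allows them to be integrated one at a time. -/
theorem HasWeakDeriv.of_succ {L : ℝ} {k : ℕ} {u v w : ℝ → ℝ} (h : HasWeakDeriv L k u v)
    (h' : HasWeakDeriv L (k + 1) u w) : HasWeakDeriv L 1 v w := by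
  refine ⟨h.2.1, h'.2.1, fun φ h1 h2 h3 => ?_⟩
  obtain ⟨d1, d2, d3⟩ := test_iteratedDeriv 1 h1 h2 h3
  have e1 := h.2.2 _ d1 d2 d3
  have e2 := h'.2.2 φ h1 h2 h3
  rw [iteratedDeriv_iteratedDeriv_one, e2] at e1
  refine mul_left_cancel₀ (pow_ne_zero k (by norm_num : (-1 : ℝ) ≠ 0)) ?_
  rw [← e1]
  ring

theorem HasWeakDeriv.zero {L : ℝ} {u : ℝ → ℝ} (h : LocallyIntegrableOn u (Ioo 0 L)) :
    HasWeakDeriv L 0 u u :=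
  ⟨h, h, fun φ _ _ _ => by simp⟩

/-- A function with an integrable weak derivative is almost everywhere equal to a primitive. -/
theorem HasWeakDeriv.exists_isPrimitive {L : ℝ} (hL : 0 < L) {v w g : ℝ → ℝ}
    (h : HasWeakDeriv L 1 v w) (hg : LocallyIntegrable g)
    (hw : w =ᵐ[volume.restrict (Ioo 0 L)] g) :
    ∃ f, IsPrimitive f g ∧ v =ᵐ[volume.restrict (Ioo 0 L)] f := by
  -- Subtracting a primitive of `g` leaves a function with zero weak derivative, that is, a
  -- constant.
  have hp := isPrimitive_integral hg 0
  have h1 : HasWeakDeriv L 1 (v + (-1 : ℝ) • fun x => 0 + ∫ t in (0 : ℝ)..x, g t) 0 := by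
    refine (h.add ((hp.hasWeakDeriv L).smul (-1))).congr_right ?_
    filter_upwards [hw] with x hx
    simp [hx]
  obtain ⟨c, hc⟩ := h1.ae_const hL
  refine ⟨_, isPrimitive_integral hg c, ?_⟩
  filter_upwards [hc] with x hx
  simp only [Pi.add_apply, Pi.smul_apply, smul_eq_mul, zero_add] at hx
  linarith

theorem memLp_two_of_continuous {L : ℝ} {f : ℝ → ℝ} (hf : Continuous f) :
    MemLp f 2 (volume.restrict (Ioo 0 L)) := by
  obtain ⟨C, hC⟩ := isCompact_Icc.exists_bound_of_continuousOn (s := Icc 0 L) hf.continuousOn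
  refine MemLp.of_bound hf.aestronglyMeasurable C ?_
  filter_upwards [ae_restrict_mem measurableSet_Ioo] with x hx
  exact hC x (Ioo_subset_Icc_self hx)

/-- The trace of a function that has a continuous representative. -/
theorem hasZeroTrace_iff {L a : ℝ} (hL : 0 < L) (ha : a ∈ Icc 0 L) {u f : ℝ → ℝ}
    (hf : Continuous f) (hu : u =ᵐ[volume.restrict (Ioo 0 L)] f) :
    HasZeroTrace L a u ↔ f a = 0 := by
  refine ⟨fun ⟨g, hg, hgu, hga⟩ => ?_, fun h => ⟨f, hf.continuousOn, hu.symm, h⟩⟩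
  have h1 : EqOn g f (Ioo 0 L) :=
    Measure.eqOn_open_of_ae_eq (hgu.trans hu) isOpen_Ioo (hg.mono Ioo_subset_Icc_self)
      hf.continuousOn
  have h2 := h1.of_subset_closure hg hf.continuousOn Ioo_subset_Icc_self (by rw [closure_Ioo hL.ne])
  rw [← h2 ha, hga]

/-- Extension by zero, since `IsPrimitive` requires a function that is locally integrable on the
whole line. -/
theorem locallyIntegrable_indicator {L : ℝ} {v : ℝ → ℝ} (hv : IntegrableOn v (Ioo 0 L)) :
    LocallyIntegrable ((Ioo 0 L).indicator v) :=
  ((integrable_indicator_iff measurableSet_Ioo).2 hv).locallyIntegrable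

theorem indicator_ae_eq_Ioo {L : ℝ} (v : ℝ → ℝ) :
    v =ᵐ[volume.restrict (Ioo 0 L)] (Ioo 0 L).indicator v := by
  filter_upwards [ae_restrict_mem measurableSet_Ioo] with x hx
  rw [indicator_of_mem hx]

/-! ### Weighted integrals -/

theorem integral_weightedMeasure (L : ℝ) (n : ℕ) (g : ℝ → ℝ) :
    ∫ x, g x ∂(weightedMeasure L fun x => ((L - x) ^ n)⁻¹) =
      ∫ x in Ioo 0 L, g x * ((L - x) ^ n)⁻¹ := by
  unfold weightedMeasure
  rw [integral_withDensity_eq_integral_toReal_smul (measurable_weight L n)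
    (Eventually.of_forall fun _ => ENNReal.ofReal_lt_top)]
  refine setIntegral_congr_fun measurableSet_Ioo fun x hx => ?_
  have : 0 < L - x := by linarith [hx.2]
  simp only [smul_eq_mul]
  rw [ENNReal.toReal_ofReal (by positivity), mul_comm]

theorem integrable_weightedMeasure_iff (L : ℝ) (n : ℕ) (g : ℝ → ℝ) :
    Integrable g (weightedMeasure L fun x => ((L - x) ^ n)⁻¹) ↔
      IntegrableOn (fun x => g x * ((L - x) ^ n)⁻¹) (Ioo 0 L) := by
  unfold weightedMeasure
  rw [integrable_withDensity_iff_integrable_smul' (measurable_weight L n)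
    (Eventually.of_forall fun _ => ENNReal.ofReal_lt_top)]
  refine integrableOn_congr_fun (fun x hx => ?_) measurableSet_Ioo
  have : 0 < L - x := by linarith [hx.2]
  simp only [smul_eq_mul]
  rw [ENNReal.toReal_ofReal (by positivity), mul_comm]

theorem muH_eq (L : ℝ) : muH L = weightedMeasure L fun x => ((L - x) ^ 1)⁻¹ := by
  simp [muH]

theorem integral_muH (L : ℝ) (g : ℝ → ℝ) :
    ∫ x, g x ∂(muH L) = ∫ x in Ioo 0 L, g x * (L - x)⁻¹ := by
  rw [muH_eq, integral_weightedMeasure]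
  simp

theorem integrable_muH_iff (L : ℝ) (g : ℝ → ℝ) :
    Integrable g (muH L) ↔ IntegrableOn (fun x => g x * (L - x)⁻¹) (Ioo 0 L) := by
  rw [muH_eq, integrable_weightedMeasure_iff]
  simp

theorem integral_muV (L : ℝ) (g : ℝ → ℝ) :
    ∫ x, g x ∂(muV L) = ∫ x in Ioo 0 L, g x * ((L - x) ^ 2)⁻¹ :=
  integral_weightedMeasure L 2 g

theorem integrable_muV_iff (L : ℝ) (g : ℝ → ℝ) :
    Integrable g (muV L) ↔ IntegrableOn (fun x => g x * ((L - x) ^ 2)⁻¹) (Ioo 0 L) :=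
  integrable_weightedMeasure_iff L 2 g

/-- On `(0, L)` one has `L - x ≤ L`, so the weight is at least `L⁻ⁿ`. Weighted integrability
therefore implies the unweighted one. -/
theorem restrict_le_weightedMeasure (L : ℝ) (n : ℕ) :
    volume.restrict (Ioo 0 L) ≤
      ENNReal.ofReal (L ^ n) • weightedMeasure L fun x => ((L - x) ^ n)⁻¹ := by
  unfold weightedMeasure
  rw [← withDensity_smul _ (measurable_weight L n)]
  conv_lhs => rw [← withDensity_one (μ := volume.restrict (Ioo 0 L))]
  refine withDensity_mono ?_
  filter_upwards [ae_restrict_mem measurableSet_Ioo] with x hx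
  have h1 : 0 < L - x := by linarith [hx.2]
  have h2 : 0 < L := hx.1.trans hx.2
  simp only [Pi.one_apply, Pi.smul_apply, smul_eq_mul]
  rw [← ENNReal.ofReal_mul (by positivity), ENNReal.one_le_ofReal, ← div_eq_mul_inv,
    one_le_div (by positivity)]
  exact pow_le_pow_left₀ h1.le (by linarith [hx.1]) n

theorem MemLp.restrict_of_muH {L : ℝ} {f : ℝ → ℝ} {p : ℝ≥0∞} (h : MemLp f p (muH L)) :
    MemLp f p (volume.restrict (Ioo 0 L)) := by
  rw [muH_eq] at h
  exact h.of_measure_le_smul ENNReal.ofReal_ne_top (restrict_le_weightedMeasure L 1)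

theorem MemLp.restrict_of_muV {L : ℝ} {f : ℝ → ℝ} {p : ℝ≥0∞} (h : MemLp f p (muV L)) :
    MemLp f p (volume.restrict (Ioo 0 L)) :=
  h.of_measure_le_smul ENNReal.ofReal_ne_top (restrict_le_weightedMeasure L 2)

theorem aestronglyMeasurable_weightedMeasure {L : ℝ} {w f : ℝ → ℝ}
    (hf : AEStronglyMeasurable f (volume.restrict (Ioo 0 L))) :
    AEStronglyMeasurable f (weightedMeasure L w) :=
  hf.mono_ac (withDensity_absolutelyContinuous _ _)

/-! ### Regular representatives of the elements of the domain -/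

/-- `u₀, …, u₄` are the derivatives of the regular representative of an element `u` of the domain
of the operator, and `f` is the image of `u`. -/
structure KawaharaRep (L β : ℝ) (u f : ℝ → ℝ) (u₀ u₁ u₂ u₃ u₄ : ℝ → ℝ) : Prop where
  ae_eq : u =ᵐ[volume.restrict (Ioo 0 L)] u₀
  prim₀ : IsPrimitive u₀ u₁
  prim₁ : IsPrimitive u₁ u₂
  prim₂ : IsPrimitive u₂ u₃
  prim₃ : IsPrimitive u₃ u₄
  -- The fifth derivative is prescribed only almost everywhere on `(0, L)`: `u₄` is absolutely
  -- continuous but need not be `C¹`.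
  prim₄ : ∃ h, IsPrimitive u₄ h ∧ h =ᵐ[volume.restrict (Ioo 0 L)] fun x => f x + β * u₃ x
  left₀ : u₀ 0 = 0
  left₁ : u₁ 0 = 0
  right₀ : u₀ L = 0
  right₁ : u₁ L = 0
  right₂ : u₂ L = 0

theorem memLp_two_coe {L : ℝ} (f : SpaceH L) : MemLp f 2 (volume.restrict (Ioo 0 L)) :=
  MemLp.restrict_of_muH (Lp.memLp f)

/-- Since `u_xxxxx = f + β u_xxx` is integrable, the chain of weak derivatives can be integrated
from the top down. Each primitive is continuous, so traces become point values. -/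
theorem KawaharaGraph.exists_rep {L β : ℝ} (hL : 0 < L) {u f : SpaceH L}
    (h : KawaharaGraph L β u f) :
    ∃ u₀ u₁ u₂ u₃ u₄ : ℝ → ℝ, KawaharaRep L β u f u₀ u₁ u₂ u₃ u₄ := by
  obtain ⟨hS, ⟨-, t0, tL, w1, hw1, t10, t1L⟩, ⟨w2, hw2, t2L⟩, w3, w5, hw3, hw5, hf⟩ := h
  obtain ⟨w4, hw4, -⟩ := hS 4 (by norm_num)
  have i5 : IntegrableOn w3 (Ioo 0 L) := by
    obtain ⟨z, hz, hz'⟩ := hS 3 (by norm_num)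
    exact ((hz'.integrable (by norm_num)).congr (hz.unique hw3))
  have if' : IntegrableOn f (Ioo 0 L) := (memLp_two_coe f).integrable (by norm_num)
  have i6 : IntegrableOn (fun x => f x + β * w3 x) (Ioo 0 L) := if'.add (i5.const_mul β)
  obtain ⟨u4, p4, e4⟩ := (hw4.of_succ hw5).exists_isPrimitive hL
    (locallyIntegrable_indicator i6) (by
      refine EventuallyEq.trans ?_ (indicator_ae_eq_Ioo _)
      filter_upwards [hf] with x hx
      rw [hx]; ring)
  obtain ⟨u3, p3, e3⟩ := (hw3.of_succ hw4).exists_isPrimitive hL p4.continuous.locallyIntegrable e4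
  obtain ⟨u2, p2, e2⟩ := (hw2.of_succ hw3).exists_isPrimitive hL p3.continuous.locallyIntegrable e3
  obtain ⟨u1, p1, e1⟩ := (hw1.of_succ hw2).exists_isPrimitive hL p2.continuous.locallyIntegrable e2
  obtain ⟨u0, p0, e0⟩ := hw1.exists_isPrimitive hL p1.continuous.locallyIntegrable e1
  have h0 : (0 : ℝ) ∈ Icc 0 L := ⟨le_rfl, hL.le⟩
  have h1 : L ∈ Icc 0 L := ⟨hL.le, le_rfl⟩
  refine ⟨u0, u1, u2, u3, u4, e0, p0, p1, p2, p3, ⟨_, p4, ?_⟩,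
    (hasZeroTrace_iff hL h0 p0.continuous e0).1 t0, (hasZeroTrace_iff hL h0 p1.continuous e1).1 t10,
    (hasZeroTrace_iff hL h1 p0.continuous e0).1 tL, (hasZeroTrace_iff hL h1 p1.continuous e1).1 t1L,
    (hasZeroTrace_iff hL h1 p2.continuous e2).1 t2L⟩
  refine (indicator_ae_eq_Ioo _).symm.trans ?_
  filter_upwards [e3] with x hx
  rw [hx]

theorem KawaharaRep.kawaharaGraph {L β : ℝ} (hL : 0 < L) {u f : SpaceH L}
    {u₀ u₁ u₂ u₃ u₄ : ℝ → ℝ} (h : KawaharaRep L β u f u₀ u₁ u₂ u₃ u₄) :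
    KawaharaGraph L β u f := by
  have c0 := h.prim₀.continuous
  have c1 := h.prim₁.continuous
  have c2 := h.prim₂.continuous
  have c3 := h.prim₃.continuous
  obtain ⟨g, p4, hg⟩ := h.prim₄
  have c4 := p4.continuous
  have d1 := h.prim₀.hasWeakDeriv L
  have d2 := d1.succ (h.prim₁.hasWeakDeriv L)
  have d3 := d2.succ (h.prim₂.hasWeakDeriv L)
  have d4 := d3.succ (h.prim₃.hasWeakDeriv L)
  have d5 := d4.succ ((p4.hasWeakDeriv L).congr_right hg)
  have e := h.ae_eq.symm
  have hm5 : MemLp (fun x => f x + β * u₃ x) 2 (volume.restrict (Ioo 0 L)) :=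
    (memLp_two_coe f).add ((memLp_two_of_continuous c3).const_mul β)
  have hS : MemSobolev L 5 u := by
    intro k hk
    interval_cases k
    · exact ⟨u, .zero (d1.congr e).1, memLp_two_coe u⟩
    · exact ⟨u₁, d1.congr e, memLp_two_of_continuous c1⟩
    · exact ⟨u₂, d2.congr e, memLp_two_of_continuous c2⟩
    · exact ⟨u₃, d3.congr e, memLp_two_of_continuous c3⟩
    · exact ⟨u₄, d4.congr e, memLp_two_of_continuous c4⟩
    · exact ⟨_, d5.congr e, hm5⟩
  have h0 : (0 : ℝ) ∈ Icc 0 L := ⟨le_rfl, hL.le⟩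
  have h1 : L ∈ Icc 0 L := ⟨hL.le, le_rfl⟩
  refine ⟨hS, ⟨fun k hk => hS k (hk.trans (by norm_num)),
    (hasZeroTrace_iff hL h0 c0 h.ae_eq).2 h.left₀, (hasZeroTrace_iff hL h1 c0 h.ae_eq).2 h.right₀,
    u₁, d1.congr e, (hasZeroTrace_iff hL h0 c1 ae_eq_rfl).2 h.left₁,
    (hasZeroTrace_iff hL h1 c1 ae_eq_rfl).2 h.right₁⟩,
    ⟨u₂, d2.congr e, (hasZeroTrace_iff hL h1 c2 ae_eq_rfl).2 h.right₂⟩,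
    u₃, _, d3.congr e, d5.congr e, ?_⟩
  filter_upwards with x
  ring

/-! ### The dissipation inequality -/

theorem IsPrimitive.integral_eq_sub {f g : ℝ → ℝ} (h : IsPrimitive f g) (a b : ℝ) :
    ∫ t in a..b, g t = f b - f a := by
  rw [h.2 b, h.2 a, ← intervalIntegral.integral_add_adjacent_intervals
    (h.1.intervalIntegrable 0 a) (h.1.intervalIntegrable a b)]
  ring

/-- Integrating back from a zero at `L` gains one power of the distance to `L`. Iteration turns the
boundary conditions at `L` into orders of vanishing. -/
theorem IsPrimitive.abs_le {L M : ℝ} {n : ℕ} {f g : ℝ → ℝ} (h : IsPrimitive f g) (hf : f L = 0)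
    (hM : 0 ≤ M) (hg : ∀ x ∈ Icc 0 L, |g x| ≤ M * (L - x) ^ n) :
    ∀ x ∈ Icc 0 L, |f x| ≤ M * (L - x) ^ (n + 1) := by
  intro x hx
  have e := h.integral_eq_sub x L
  have hb : ‖∫ t in x..L, g t‖ ≤ M * (L - x) ^ n * |L - x| := by
    refine intervalIntegral.norm_integral_le_of_norm_le_const fun t ht => ?_
    rw [uIoc_of_le hx.2] at ht
    refine (hg t ⟨hx.1.trans ht.1.le, ht.2⟩).trans ?_
    have : L - t ≤ L - x := by linarith [ht.1]
    have : 0 ≤ L - t := by linarith [ht.2]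
    gcongr
  rw [e, hf, zero_sub, norm_neg, Real.norm_eq_abs,
    abs_of_nonneg (sub_nonneg.2 hx.2)] at hb
  rw [pow_succ, ← mul_assoc]
  exact hb

/-- The relation `w' = w²` keeps every differentiated expression polynomial in `w` and the
derivatives of `u`. -/
theorem hasDerivAt_weight {L x : ℝ} (hx : x ≠ L) :
    HasDerivAt (fun x => (L - x)⁻¹) ((L - x)⁻¹ ^ 2) x := by
  have h : L - x ≠ 0 := sub_ne_zero.2 hx.symm
  have := ((hasDerivAt_id x).const_sub L).inv h
  convert! this using 1
  simp [div_eq_mul_inv]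

/-! ### The energy flux and its derivative -/

/-- The boundary terms of the energy identity, as a polynomial in the derivatives of `u` and the
weight `w`. -/
noncomputable def energyFlux (β a₁ a₂ a₃ a₄ w u₀ u₁ u₂ u₃ : ℝ) : ℝ :=
  -(u₃ * u₁ * w) - u₃ * u₀ * w ^ 2 + u₂ ^ 2 * w / 2 + 2 * u₂ * u₁ * w ^ 2 + 2 * u₂ * u₀ * w ^ 3 +
    3 * u₁ ^ 2 * w ^ 3 + 6 * u₀ * u₁ * w ^ 4 + 3 * u₀ ^ 2 * w ^ 5 -
    β * (u₂ * u₀ * w - u₁ ^ 2 * w / 2 - u₁ * u₀ * w ^ 2 + u₀ ^ 2 * w ^ 3) +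
    -- Null terms: they vanish at both ends under the boundary conditions, so their derivatives
    -- integrate to zero and the coefficients are free. They encode the Hardy inequalities.
    a₁ * (u₀ ^ 2 * w ^ 3) + a₂ * (u₀ * u₁ * w ^ 2) + a₃ * (u₁ ^ 2 * w ^ 3) +
    a₄ * (u₀ ^ 2 * w ^ 5)

/-- The derivative of the flux `u₄ u₀ w + energyFlux`. -/
noncomputable def energyFluxDeriv (β a₁ a₂ a₃ a₄ w u₀ u₁ u₂ u₃ u₅ : ℝ) : ℝ :=
  (u₅ - β * u₃) * u₀ * w + 1 / 10 * (u₂ * w) ^ 2 +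
    -- Modulo total derivatives this square equals `(12/5) u₂² w² - 15 u₁² w⁴ + 60 u₀² w⁶`. It
    -- absorbs both lower terms of the fifth-order form, and `5/2 - 12/5 = 1/10` remains in front of
    -- `u₂² w²`.
    12 / 5 * (u₂ * w + 5 / 2 * (u₁ * w ^ 2) + 5 / 2 * (u₀ * w ^ 3)) ^ 2 +
    β * (3 / 2 * (u₁ * w) ^ 2 - 3 * (u₀ * w ^ 2) ^ 2) +
    a₁ * (2 * u₀ * u₁ * w ^ 3 + 3 * u₀ ^ 2 * w ^ 4) +
    a₂ * (u₁ ^ 2 * w ^ 2 + u₀ * u₂ * w ^ 2 + 2 * u₀ * u₁ * w ^ 3) +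
    a₃ * (2 * u₁ * u₂ * w ^ 3 + 3 * u₁ ^ 2 * w ^ 4) +
    a₄ * (2 * u₀ * u₁ * w ^ 5 + 5 * u₀ ^ 2 * w ^ 6)

theorem hasDerivAt_flux {β a₁ a₂ a₃ a₄ w₁ x h : ℝ} {w u₀ u₁ u₂ u₃ u₄ : ℝ → ℝ}
    (hw : HasDerivAt w w₁ x) (hw₁ : w₁ = w x ^ 2) (h0 : HasDerivAt u₀ (u₁ x) x)
    (h1 : HasDerivAt u₁ (u₂ x) x) (h2 : HasDerivAt u₂ (u₃ x) x) (h3 : HasDerivAt u₃ (u₄ x) x)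
    (h4 : HasDerivAt u₄ h x) :
    HasDerivAt
      (fun x => u₄ x * (u₀ x * w x) +
        energyFlux β a₁ a₂ a₃ a₄ (w x) (u₀ x) (u₁ x) (u₂ x) (u₃ x))
      (energyFluxDeriv β a₁ a₂ a₃ a₄ (w x) (u₀ x) (u₁ x) (u₂ x) (u₃ x) h) x := by
  unfold energyFlux energyFluxDeriv
  have w2 := hw.fun_pow 2
  have w3 := hw.fun_pow 3
  have w4 := hw.fun_pow 4
  have w5 := hw.fun_pow 5
  have q0 := h0.fun_pow 2
  have q1 := h1.fun_pow 2
  have q2 := h2.fun_pow 2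
  have key := (h4.fun_mul (h0.fun_mul hw)).fun_add
    ((((((((((((((h3.fun_mul h1).fun_mul hw).fun_neg).fun_sub ((h3.fun_mul h0).fun_mul w2)).fun_add
      ((q2.fun_mul hw).div_const 2)).fun_add (((h2.const_mul 2).fun_mul h1).fun_mul w2)).fun_add
      (((h2.const_mul 2).fun_mul h0).fun_mul w3)).fun_add ((q1.const_mul 3).fun_mul w3)).fun_add
      (((h0.const_mul 6).fun_mul h1).fun_mul w4)).fun_add ((q0.const_mul 3).fun_mul w5)).fun_sub
      ((((((h2.fun_mul h0).fun_mul hw).fun_sub ((q1.fun_mul hw).div_const 2)).fun_sub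
        ((h1.fun_mul h0).fun_mul w2)).fun_add (q0.fun_mul w3)).const_mul β)).fun_add
      ((q0.fun_mul w3).const_mul a₁)).fun_add (((h0.fun_mul h1).fun_mul w2).const_mul a₂)).fun_add
      ((q1.fun_mul w3).const_mul a₃) |>.fun_add ((q0.fun_mul w5).const_mul a₄))
  refine key.congr_deriv ?_
  subst hw₁
  ring

/-! ### Pointwise coercivity of the flux derivative -/

theorem pow_two_le_add {w : ℝ} (hw : 0 ≤ w) : w ^ 2 ≤ w ^ 6 + w := by
  rcases le_total w 1 with h | h
  · have : w ^ 2 ≤ w ^ 1 := pow_le_pow_of_le_one hw h (by norm_num)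
    have : 0 ≤ w ^ 6 := by positivity
    linarith
  · have : w ^ 2 ≤ w ^ 6 := pow_le_pow_right₀ h (by norm_num)
    linarith

theorem pow_four_le_add {w : ℝ} (hw : 0 ≤ w) : w ^ 4 ≤ w ^ 6 + w := by
  rcases le_total w 1 with h | h
  · have : w ^ 4 ≤ w ^ 1 := pow_le_pow_of_le_one hw h (by norm_num)
    have : 0 ≤ w ^ 6 := by positivity
    linarith
  · have : w ^ 4 ≤ w ^ 6 := pow_le_pow_right₀ h (by norm_num)
    linarith

/-- The null terms complete the remaining quadratic form to squares. Their coefficients depend on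
`β`, whereas the constants `1/20` and `1/10` do not; this is the source of the uniformity in `β`. -/
theorem exists_energyFluxDeriv_ge {β : ℝ} (hβ : -(3 / 80 : ℝ) < β) :
    ∃ a₁ a₂ a₃ a₄ : ℝ, ∀ w u₀ u₁ u₂ u₃ u₅ : ℝ, 0 ≤ w →
      (u₅ - β * u₃) * u₀ * w + 1 / 20 * (u₂ * w) ^ 2 - 1 / 10 * (u₀ ^ 2 * w) ≤
        energyFluxDeriv β a₁ a₂ a₃ a₄ w u₀ u₁ u₂ u₃ u₅ := by
  rcases le_or_gt 0 β with h | h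
  · refine ⟨9 / 4 * β, 0, 0, 0, fun w u₀ u₁ u₂ u₃ u₅ hw => ?_⟩
    have e : energyFluxDeriv β (9 / 4 * β) 0 0 0 w u₀ u₁ u₂ u₃ u₅ = (u₅ - β * u₃) * u₀ * w +
        1 / 10 * (u₂ * w) ^ 2 +
        12 / 5 * (u₂ * w + 5 / 2 * (u₁ * w ^ 2) + 5 / 2 * (u₀ * w ^ 3)) ^ 2 +
        β * (3 / 2 * (u₁ * w + 3 / 2 * (u₀ * w ^ 2)) ^ 2 + 3 / 8 * (u₀ * w ^ 2) ^ 2) := by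
      unfold energyFluxDeriv; ring
    rw [e]
    have := sq_nonneg (u₂ * w)
    have : 0 ≤ u₀ ^ 2 * w := by positivity
    have : 0 ≤ β * (3 / 2 * (u₁ * w + 3 / 2 * (u₀ * w ^ 2)) ^ 2 + 3 / 8 * (u₀ * w ^ 2) ^ 2) := by
      positivity
    have := sq_nonneg (u₂ * w + 5 / 2 * (u₁ * w ^ 2) + 5 / 2 * (u₀ * w ^ 3))
    linarith
  · obtain ⟨b, rfl⟩ : ∃ b, β = -b := ⟨-β, by ring⟩
    have hb : 0 < b := by linarith
    -- The second coefficient removes `-(3/2) b u₁² w²`, and the first removes the cross term `u₀ u₁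
    -- w³` that this creates. The last two add `9/4 b` times a null combination expressing `∫ u₀² w⁶
    -- ≤ (16/225) ∫ u₂² w²`, a chain of two Hardy inequalities with constants `4/9` and `4/25`.
    refine ⟨-(3 / 2) * b, 3 / 2 * b, 6 / 25 * b, 9 / 10 * b, fun w u₀ u₁ u₂ u₃ u₅ hw => ?_⟩
    have e : energyFluxDeriv (-b) (-(3 / 2) * b) (3 / 2 * b) (6 / 25 * b) (9 / 10 * b)
        w u₀ u₁ u₂ u₃ u₅ = (u₅ - -b * u₃) * u₀ * w + 1 / 10 * (u₂ * w) ^ 2 +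
        12 / 5 * (u₂ * w + 5 / 2 * (u₁ * w ^ 2) + 5 / 2 * (u₀ * w ^ 3)) ^ 2 +
        b * (-(3 / 2) * (u₀ ^ 2 * w ^ 4 - u₀ * u₂ * w ^ 2) +
          9 / 4 * (u₀ ^ 2 * w ^ 6 - 16 / 225 * (u₂ * w) ^ 2 +
            16 / 225 * (u₂ * w + 3 / 2 * (u₁ * w ^ 2)) ^ 2 +
            4 / 25 * (u₁ * w ^ 2 + 5 / 2 * (u₀ * w ^ 3)) ^ 2)) := by
      unfold energyFluxDeriv; ring
    rw [e]
    have s1 := sq_nonneg (u₂ * w + 5 / 2 * (u₁ * w ^ 2) + 5 / 2 * (u₀ * w ^ 3))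
    have s2 := sq_nonneg (u₂ * w + 3 / 2 * (u₁ * w ^ 2))
    have s3 := sq_nonneg (u₁ * w ^ 2 + 5 / 2 * (u₀ * w ^ 3))
    -- Intermediate powers of `w` are split between `w⁶`, controlled by `u₂² w²`, and `w`, the
    -- weight of `H`.
    have s4 : u₀ ^ 2 * w ^ 4 ≤ u₀ ^ 2 * w ^ 6 + u₀ ^ 2 * w := by
      rw [← mul_add]; exact mul_le_mul_of_nonneg_left (pow_four_le_add hw) (sq_nonneg _)
    have s5 : u₀ ^ 2 * w ^ 2 ≤ u₀ ^ 2 * w ^ 6 + u₀ ^ 2 * w := by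
      rw [← mul_add]; exact mul_le_mul_of_nonneg_left (pow_two_le_add hw) (sq_nonneg _)
    have s6 : -(u₀ * u₂ * w ^ 2) ≤ (u₂ * w) ^ 2 / 2 + u₀ ^ 2 * w ^ 2 / 2 := by
      have := sq_nonneg (u₂ * w + u₀ * w)
      linarith [show (u₂ * w + u₀ * w) ^ 2 = (u₂ * w) ^ 2 + 2 * (u₀ * u₂ * w ^ 2) + u₀ ^ 2 * w ^ 2
        by ring]
    have s7 : 0 ≤ (u₂ * w) ^ 2 := sq_nonneg _
    have s8 : 0 ≤ u₀ ^ 2 * w := by positivity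
    -- The `u₀² w⁶` terms cancel because `3/2 + 3/4 = 9/4`. The coefficient of `u₂² w²` is `-(3/4 +
    -- 4/25)`, which is at least `-1`.
    have key : -(u₂ * w) ^ 2 - 9 / 4 * (u₀ ^ 2 * w) ≤
        -(3 / 2) * (u₀ ^ 2 * w ^ 4 - u₀ * u₂ * w ^ 2) +
          9 / 4 * (u₀ ^ 2 * w ^ 6 - 16 / 225 * (u₂ * w) ^ 2 +
            16 / 225 * (u₂ * w + 3 / 2 * (u₁ * w ^ 2)) ^ 2 +
            4 / 25 * (u₁ * w ^ 2 + 5 / 2 * (u₀ * w ^ 3)) ^ 2) := by linarith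
    have key' := mul_le_mul_of_nonneg_left key hb.le
    -- The bound on `b` suffices since `1/10 - 3/80 = 1/16 ≥ 1/20` and `9/4 · 3/80 = 27/320 ≤ 1/10`.
    have k1 : b * (u₂ * w) ^ 2 ≤ 3 / 80 * (u₂ * w) ^ 2 :=
      mul_le_mul_of_nonneg_right (by linarith) s7
    have k2 : b * (u₀ ^ 2 * w) ≤ 3 / 80 * (u₀ ^ 2 * w) :=
      mul_le_mul_of_nonneg_right (by linarith) s8
    linarith

/-! ### Boundary behaviour and integration of the flux -/

/-- A function that vanishes to the orders prescribed by the boundary conditions has a flux that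
is bounded by a multiple of the distance to the end point. -/
theorem exists_energyFlux_le (β a₁ a₂ a₃ a₄ M L : ℝ) :
    ∃ C : ℝ, ∀ y u₀ u₁ u₂ u₃ u₄ : ℝ, 0 < y → y ≤ L → |u₀| ≤ M * y ^ 3 → |u₁| ≤ M * y ^ 2 →
      |u₂| ≤ M * y ^ 1 → |u₃| ≤ M → |u₄| ≤ M →
      |u₄ * (u₀ * y⁻¹) + energyFlux β a₁ a₂ a₃ a₄ y⁻¹ u₀ u₁ u₂ u₃| ≤ C * y := by
  -- The flux divided by `y`, in the rescaled variables `u₀/y³, u₁/y², u₂/y, u₃, u₄, y`. No negative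
  -- power of `y` survives, so it is a polynomial, bounded on the compact box.
  let F : ℝ × ℝ × ℝ × ℝ × ℝ × ℝ → ℝ := fun z =>
    z.2.2.2.2.1 * z.1 * z.2.2.2.2.2 - z.2.2.2.1 * z.2.1 - z.2.2.2.1 * z.1 + z.2.2.1 ^ 2 / 2 +
      2 * z.2.2.1 * z.2.1 + 2 * z.2.2.1 * z.1 + 3 * z.2.1 ^ 2 + 6 * z.1 * z.2.1 + 3 * z.1 ^ 2 -
      β * (z.2.2.1 * z.1 - z.2.1 ^ 2 / 2 - z.2.1 * z.1 + z.1 ^ 2) * z.2.2.2.2.2 ^ 2 +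
      a₁ * z.1 ^ 2 * z.2.2.2.2.2 ^ 2 + a₂ * (z.1 * z.2.1) * z.2.2.2.2.2 ^ 2 +
      a₃ * z.2.1 ^ 2 + a₄ * z.1 ^ 2
  have hF : Continuous F := by fun_prop
  have hK : IsCompact (Icc (-M) M ×ˢ Icc (-M) M ×ˢ Icc (-M) M ×ˢ Icc (-M) M ×ˢ Icc (-M) M ×ˢ
      Icc 0 L) := by
    repeat' apply IsCompact.prod
    all_goals exact isCompact_Icc
  obtain ⟨C, hC⟩ := hK.exists_bound_of_continuousOn hF.continuousOn
  refine ⟨C, fun y u₀ u₁ u₂ u₃ u₄ hy hyL h0 h1 h2 h3 h4 => ?_⟩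
  have hd : ∀ (n : ℕ) (v : ℝ), |v| ≤ M * y ^ n → v / y ^ n ∈ Icc (-M) M := by
    intro n v hv
    rw [mem_Icc, ← abs_le, abs_div, abs_of_pos (pow_pos hy n)]
    exact (div_le_iff₀ (pow_pos hy n)).2 hv
  have := hC (u₀ / y ^ 3, u₁ / y ^ 2, u₂ / y ^ 1, u₃, u₄, y)
    ⟨hd 3 _ h0, hd 2 _ h1, hd 1 _ h2, abs_le.1 h3, abs_le.1 h4, hy.le, hyL⟩
  have e : u₄ * (u₀ * y⁻¹) + energyFlux β a₁ a₂ a₃ a₄ y⁻¹ u₀ u₁ u₂ u₃ =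
      F (u₀ / y ^ 3, u₁ / y ^ 2, u₂ / y ^ 1, u₃, u₄, y) * y := by
    simp only [F, energyFlux]
    field_simp
    ring
  rw [e, abs_mul, abs_of_pos hy]
  exact mul_le_mul_of_nonneg_right this hy.le

/-- `u₃` and `u₄` are bounded by continuity; the three conditions at `L` then give the orders 1, 2,
3 by successive integration. -/
theorem KawaharaRep.exists_bound {L β : ℝ} {u f u₀ u₁ u₂ u₃ u₄ : ℝ → ℝ}
    (h : KawaharaRep L β u f u₀ u₁ u₂ u₃ u₄) :
    ∃ M : ℝ, 0 ≤ M ∧ ∀ x ∈ Icc 0 L, |u₀ x| ≤ M * (L - x) ^ 3 ∧ |u₁ x| ≤ M * (L - x) ^ 2 ∧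
      |u₂ x| ≤ M * (L - x) ^ 1 ∧ |u₃ x| ≤ M ∧ |u₄ x| ≤ M := by
  obtain ⟨_, p4, _⟩ := h.prim₄
  obtain ⟨M₃, h3⟩ := isCompact_Icc.exists_bound_of_continuousOn (s := Icc 0 L)
    h.prim₃.continuous.continuousOn
  obtain ⟨M₄, h4⟩ := isCompact_Icc.exists_bound_of_continuousOn (s := Icc 0 L)
    p4.continuous.continuousOn
  have hM : 0 ≤ max (max M₃ M₄) 0 := le_max_right _ _
  have h3' : ∀ x ∈ Icc 0 L, |u₃ x| ≤ max (max M₃ M₄) 0 := fun x hx =>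
    (h3 x hx).trans ((le_max_left _ _).trans (le_max_left _ _))
  have h4' : ∀ x ∈ Icc 0 L, |u₄ x| ≤ max (max M₃ M₄) 0 := fun x hx =>
    (h4 x hx).trans ((le_max_right _ _).trans (le_max_left _ _))
  have b2 := h.prim₂.abs_le (n := 0) h.right₂ hM (by simpa using h3')
  have b1 := h.prim₁.abs_le h.right₁ hM b2
  have b0 := h.prim₀.abs_le h.right₀ hM b1
  exact ⟨_, hM, fun x hx => ⟨b0 x hx, b1 x hx, b2 x hx, h3' x hx, h4' x hx⟩⟩

theorem ContDiff.of_isPrimitive {f g : ℝ → ℝ} (h : IsPrimitive f g) (hg : Continuous g) :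
    ContDiff ℝ 1 f := by
  rw [contDiff_one_iff_deriv]
  exact ⟨fun x => (h.hasDerivAt hg x).differentiableAt,
    (funext fun x => (h.hasDerivAt hg x).deriv : deriv f = g) ▸ hg⟩

theorem ContDiffOn.energyFlux {β a₁ a₂ a₃ a₄ : ℝ} {s : Set ℝ} {w u₀ u₁ u₂ u₃ : ℝ → ℝ}
    (hw : ContDiffOn ℝ 1 w s) (h0 : ContDiffOn ℝ 1 u₀ s) (h1 : ContDiffOn ℝ 1 u₁ s)
    (h2 : ContDiffOn ℝ 1 u₂ s) (h3 : ContDiffOn ℝ 1 u₃ s) :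
    ContDiffOn ℝ 1
      (fun x => _root_.energyFlux β a₁ a₂ a₃ a₄ (w x) (u₀ x) (u₁ x) (u₂ x) (u₃ x)) s := by
  unfold _root_.energyFlux
  fun_prop

/-- The fundamental theorem of calculus for the flux. -/
theorem KawaharaRep.integral_energyFluxDeriv {L β : ℝ} {u f u₀ u₁ u₂ u₃ u₄ : ℝ → ℝ}
    (h : KawaharaRep L β u f u₀ u₁ u₂ u₃ u₄) (a₁ a₂ a₃ a₄ : ℝ) {b : ℝ} (hb : 0 ≤ b) (hbL : b < L) :
    IntervalIntegrable (fun x => energyFluxDeriv β a₁ a₂ a₃ a₄ (L - x)⁻¹ (u₀ x) (u₁ x) (u₂ x)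
      (u₃ x) (f x + β * u₃ x)) volume 0 b ∧
    ∫ x in (0 : ℝ)..b, energyFluxDeriv β a₁ a₂ a₃ a₄ (L - x)⁻¹ (u₀ x) (u₁ x) (u₂ x) (u₃ x)
        (f x + β * u₃ x) =
      (u₄ b * (u₀ b * (L - b)⁻¹) +
        energyFlux β a₁ a₂ a₃ a₄ (L - b)⁻¹ (u₀ b) (u₁ b) (u₂ b) (u₃ b)) - u₂ 0 ^ 2 * L⁻¹ / 2 := by
  have c1 := h.prim₁.continuous
  have c2 := h.prim₂.continuous
  have c3 := h.prim₃.continuous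
  obtain ⟨g, p4, hg⟩ := h.prim₄
  have c4 := p4.continuous
  have k0 := ContDiff.of_isPrimitive h.prim₀ c1
  have k1 := ContDiff.of_isPrimitive h.prim₁ c2
  have k2 := ContDiff.of_isPrimitive h.prim₂ c3
  have k3 := ContDiff.of_isPrimitive h.prim₃ c4
  have hne : ∀ x ∈ uIcc 0 b, L - x ≠ 0 := by
    intro x hx
    rw [uIcc_of_le hb] at hx
    linarith [hx.2]
  have hw : ContDiffOn ℝ 1 (fun x : ℝ => (L - x)⁻¹) (uIcc 0 b) :=
    (contDiff_const.sub contDiff_id).contDiffOn.inv hne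
  have hφ : ContDiffOn ℝ 1 (fun x : ℝ => u₀ x * (L - x)⁻¹) (uIcc 0 b) := k0.contDiffOn.mul hw
  have hG : ContDiffOn ℝ 1 (fun x : ℝ => energyFlux β a₁ a₂ a₃ a₄ (L - x)⁻¹ (u₀ x) (u₁ x) (u₂ x)
      (u₃ x)) (uIcc 0 b) :=
    hw.energyFlux k0.contDiffOn k1.contDiffOn k2.contDiffOn k3.contDiffOn
  -- Only `u₄` fails to be `C¹`, and it enters the flux through a single product. Away from `L` the
  -- flux is thus absolutely continuous.
  have hAC := ((p4.absolutelyContinuous 0 b).fun_mul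
    hφ.absolutelyContinuousOnInterval).fun_add hG.absolutelyContinuousOnInterval
  have hae : ∀ᵐ x, x ∈ uIoc 0 b → deriv (fun x => u₄ x * (u₀ x * (L - x)⁻¹) +
      energyFlux β a₁ a₂ a₃ a₄ (L - x)⁻¹ (u₀ x) (u₁ x) (u₂ x) (u₃ x)) x =
      energyFluxDeriv β a₁ a₂ a₃ a₄ (L - x)⁻¹ (u₀ x) (u₁ x) (u₂ x) (u₃ x) (f x + β * u₃ x) := by
    filter_upwards [p4.ae_hasDerivAt, (ae_restrict_iff' measurableSet_Ioo).1 hg] with x hx hgx hxb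
    rw [uIoc_of_le hb] at hxb
    have hxL : x < L := hxb.2.trans_lt hbL
    rw [hgx ⟨hxb.1, hxL⟩] at hx
    exact (hasDerivAt_flux (hasDerivAt_weight hxL.ne) rfl (h.prim₀.hasDerivAt c1 x)
      (h.prim₁.hasDerivAt c2 x) (h.prim₂.hasDerivAt c3 x) (h.prim₃.hasDerivAt c4 x) hx).deriv
  have hae' := (ae_restrict_iff' measurableSet_uIoc).2 hae
  refine ⟨hAC.intervalIntegrable_deriv.congr_ae hae', ?_⟩
  rw [← intervalIntegral.integral_congr_ae hae, hAC.integral_deriv_eq_sub]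
  -- At `0` all terms contain `u₀` or `u₁` except `u₂² w / 2`, with `w = L⁻¹`.
  simp [energyFlux, h.left₀, h.left₁]

theorem integrableOn_Ioo_of_bound {L C : ℝ} {g : ℝ → ℝ} (hg : ContinuousOn g (Ioo 0 L))
    (hC : ∀ x ∈ Ioo 0 L, |g x| ≤ C) : IntegrableOn g (Ioo 0 L) := by
  refine IntegrableOn.of_bound (by simp) (hg.aestronglyMeasurable measurableSet_Ioo) C ?_
  filter_upwards [ae_restrict_mem measurableSet_Ioo] with x hx using hC x hx

theorem continuousOn_weight (L : ℝ) : ContinuousOn (fun x : ℝ => (L - x)⁻¹) (Ioo 0 L) :=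
  (continuous_const.sub continuous_id).continuousOn.inv₀ fun _ hx => sub_ne_zero.2 hx.2.ne'

theorem abs_mul_weight_pow_le {L M x v : ℝ} {n : ℕ} (hx : x < L) (hv : |v| ≤ M * (L - x) ^ n) :
    |v * (L - x)⁻¹ ^ n| ≤ M := by
  have hy : 0 < L - x := sub_pos.2 hx
  rw [inv_pow, ← div_eq_mul_inv, abs_div, abs_of_pos (pow_pos hy n)]
  exact (div_le_iff₀ (pow_pos hy n)).2 hv

theorem KawaharaRep.integrableOn_sq {L β : ℝ} {u f u₀ u₁ u₂ u₃ u₄ : ℝ → ℝ}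
    (h : KawaharaRep L β u f u₀ u₁ u₂ u₃ u₄) :
    IntegrableOn (fun x => u₀ x ^ 2 * (L - x)⁻¹) (Ioo 0 L) := by
  obtain ⟨M, hM, hb⟩ := h.exists_bound
  refine integrableOn_Ioo_of_bound
    ((h.prim₀.continuous.continuousOn.pow 2).mul (continuousOn_weight L)) (C := M ^ 2 * L ^ 5)
    fun x hx => ?_
  have hy : 0 < L - x := sub_pos.2 hx.2
  have h1 : L - x ≤ L := by linarith [hx.1]
  rw [abs_mul, abs_pow, abs_of_pos (inv_pos.2 hy), ← div_eq_mul_inv, div_le_iff₀ hy]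
  calc |u₀ x| ^ 2 ≤ (M * (L - x) ^ 3) ^ 2 :=
        pow_le_pow_left₀ (abs_nonneg _) (hb x (Ioo_subset_Icc_self hx)).1 2
    _ = M ^ 2 * (L - x) ^ 5 * (L - x) := by ring
    _ ≤ M ^ 2 * L ^ 5 * (L - x) := by gcongr

/-- The dissipation inequality for regular representatives. -/
theorem KawaharaRep.energy {L β : ℝ} (hL : 0 < L) (hβ : -(3 / 80 : ℝ) < β)
    {u f u₀ u₁ u₂ u₃ u₄ : ℝ → ℝ} (h : KawaharaRep L β u f u₀ u₁ u₂ u₃ u₄)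
    (hf : IntegrableOn f (Ioo 0 L)) :
    IntegrableOn (fun x => u₂ x ^ 2 * ((L - x) ^ 2)⁻¹) (Ioo 0 L) ∧
      (∫ x in Ioo 0 L, f x * u₀ x * (L - x)⁻¹) +
        1 / 20 * ∫ x in Ioo 0 L, u₂ x ^ 2 * ((L - x) ^ 2)⁻¹ ≤
      1 / 10 * ∫ x in Ioo 0 L, u₀ x ^ 2 * (L - x)⁻¹ := by
  obtain ⟨M, hM, hb⟩ := h.exists_bound
  obtain ⟨a₁, a₂, a₃, a₄, ha⟩ := exists_energyFluxDeriv_ge hβ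
  obtain ⟨C, hC⟩ := exists_energyFlux_le β a₁ a₂ a₃ a₄ M L
  have c0 := h.prim₀.continuous.continuousOn (s := Ioo 0 L)
  have c2 := h.prim₂.continuous.continuousOn (s := Ioo 0 L)
  have cw := continuousOn_weight L
  have b0 : ∀ x ∈ Ioo 0 L, |u₀ x * (L - x)⁻¹| ≤ M * L ^ 2 := by
    intro x hx
    have hy : 0 < L - x := sub_pos.2 hx.2
    have := abs_mul_weight_pow_le (n := 1) (M := M * (L - x) ^ 2) (v := u₀ x) hx.2
      (by rw [mul_assoc, ← pow_add]; exact (hb x (Ioo_subset_Icc_self hx)).1)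
    rw [pow_one] at this
    refine this.trans ?_
    have : L - x ≤ L := by linarith [hx.1]
    gcongr
  have b2 : ∀ x ∈ Ioo 0 L, |u₂ x * (L - x)⁻¹| ≤ M := by
    intro x hx
    have := abs_mul_weight_pow_le hx.2 (hb x (Ioo_subset_Icc_self hx)).2.2.1
    rwa [pow_one] at this
  have i2 : IntegrableOn (fun x => (u₂ x * (L - x)⁻¹) ^ 2) (Ioo 0 L) := by
    refine integrableOn_Ioo_of_bound ((c2.mul cw).pow 2) (C := M ^ 2) fun x hx => ?_
    rw [abs_pow]
    exact pow_le_pow_left₀ (abs_nonneg _) (b2 x hx) 2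
  have i0 := h.integrableOn_sq
  have i1 : IntegrableOn (fun x => f x * u₀ x * (L - x)⁻¹) (Ioo 0 L) := by
    simp only [mul_assoc]
    refine Integrable.mul_bdd (c := M * L ^ 2) hf
      ((c0.mul cw).aestronglyMeasurable measurableSet_Ioo) ?_
    filter_upwards [ae_restrict_mem measurableSet_Ioo] with x hx using b0 x hx
  have e2 : (fun x => u₂ x ^ 2 * ((L - x) ^ 2)⁻¹) = fun x => (u₂ x * (L - x)⁻¹) ^ 2 := by
    ext x
    rw [mul_pow, inv_pow]
  rw [e2]
  refine ⟨i2, ?_⟩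
  set F : ℝ → ℝ := fun x => f x * u₀ x * (L - x)⁻¹ + 1 / 20 * (u₂ x * (L - x)⁻¹) ^ 2 -
    1 / 10 * (u₀ x ^ 2 * (L - x)⁻¹) with hF
  have i12 : IntegrableOn (fun x => f x * u₀ x * (L - x)⁻¹ + 1 / 20 * (u₂ x * (L - x)⁻¹) ^ 2)
    (Ioo 0 L) := i1.add (i2.const_mul _)
  have iF : IntegrableOn F (Ioo 0 L) := i12.sub (i0.const_mul _)
  have eF : ∫ x in Ioo 0 L, F x = (∫ x in Ioo 0 L, f x * u₀ x * (L - x)⁻¹) +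
      1 / 20 * (∫ x in Ioo 0 L, (u₂ x * (L - x)⁻¹) ^ 2) -
      1 / 10 * ∫ x in Ioo 0 L, u₀ x ^ 2 * (L - x)⁻¹ := by
    simp only [hF]
    rw [integral_sub i12 (i0.const_mul _),
      integral_add i1 (i2.const_mul _), integral_const_mul, integral_const_mul]
  have iF' : IntervalIntegrable F volume 0 L := by
    rwa [intervalIntegrable_iff_integrableOn_Ioo_of_le hL.le]
  -- The weight is singular at `L`, so the identity is used on `(0, b)` with `b < L`. The flux at
  -- `b` is `O(L - b)`, the term from `0` has the good sign and is dropped, and then `b → L`.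
  have key : ∀ b ∈ Ioo 0 L, ∫ x in (0 : ℝ)..b, F x ≤ C * (L - b) := by
    intro b hbL
    obtain ⟨hi, hval⟩ := h.integral_energyFluxDeriv a₁ a₂ a₃ a₄ hbL.1.le hbL.2
    have hle : ∫ x in (0 : ℝ)..b, F x ≤ ∫ x in (0 : ℝ)..b, energyFluxDeriv β a₁ a₂ a₃ a₄ (L - x)⁻¹
        (u₀ x) (u₁ x) (u₂ x) (u₃ x) (f x + β * u₃ x) := by
      refine intervalIntegral.integral_mono_on hbL.1.le (iF'.mono_set ?_) hi fun x hx => ?_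
      · rw [uIcc_of_le hbL.1.le, uIcc_of_le hL.le]
        exact Icc_subset_Icc_right hbL.2.le
      · have hw : 0 ≤ (L - x)⁻¹ := inv_nonneg.2 (by linarith [hx.2, hbL.2])
        have := ha (L - x)⁻¹ (u₀ x) (u₁ x) (u₂ x) (u₃ x) (f x + β * u₃ x) hw
        rwa [add_sub_cancel_right] at this
    refine hle.trans (hval.le.trans ?_)
    obtain ⟨q0, q1, q2, q3, q4⟩ := hb b (Ioo_subset_Icc_self hbL)
    have q := (le_abs_self _).trans (hC (L - b) (u₀ b) (u₁ b) (u₂ b) (u₃ b) (u₄ b)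
      (sub_pos.2 hbL.2) (by linarith [hbL.1]) q0 q1 q2 q3 q4)
    have : 0 ≤ u₂ 0 ^ 2 * L⁻¹ / 2 := by positivity
    linarith
  have hlim : ∫ x in (0 : ℝ)..L, F x ≤ 0 := by
    have hc : ContinuousWithinAt (fun b => ∫ x in (0 : ℝ)..b, F x) (Ioo 0 L) L := by
      have := intervalIntegral.continuousOn_primitive_interval (a := 0) (b := L) (f := F)
        (μ := volume) (by
          rw [uIcc_of_le hL.le]
          exact (intervalIntegrable_iff_integrableOn_Icc_of_le hL.le).1 iF')
      exact (this L right_mem_uIcc).mono (by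
        rw [uIcc_of_le hL.le]; exact Ioo_subset_Icc_self)
    have hr : Tendsto (fun b => C * (L - b)) (𝓝[Ioo 0 L] L) (𝓝 0) := by
      have : Continuous fun b => C * (L - b) := by fun_prop
      have := this.tendsto L
      rw [sub_self, mul_zero] at this
      exact this.mono_left nhdsWithin_le_nhds
    have : (𝓝[Ioo 0 L] L).NeBot := by
      rw [← mem_closure_iff_nhdsWithin_neBot, closure_Ioo hL.ne]
      exact ⟨hL.le, le_rfl⟩
    refine le_of_tendsto_of_tendsto hc hr ?_
    filter_upwards [self_mem_nhdsWithin] with b hb using key b hb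
  rw [intervalIntegral.integral_of_le hL.le, integral_Ioc_eq_integral_Ioo, eF] at hlim
  linarith

/-! ### The norms of `H` and `V` -/

theorem inner_spaceH {L : ℝ} (f u : SpaceH L) {f' u' : ℝ → ℝ}
    (hf : f =ᵐ[volume.restrict (Ioo 0 L)] f') (hu : u =ᵐ[volume.restrict (Ioo 0 L)] u') :
    inner ℝ f u = ∫ x in Ioo 0 L, f' x * u' x * (L - x)⁻¹ := by
  rw [L2.inner_def, ← integral_muH]
  refine integral_congr_ae ((ae_muH_iff L).2 ?_)
  filter_upwards [hf, hu] with x hx hx'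
  simp [hx, hx', mul_comm]

theorem norm_sq_spaceH {L : ℝ} (u : SpaceH L) {u' : ℝ → ℝ}
    (hu : u =ᵐ[volume.restrict (Ioo 0 L)] u') :
    ‖u‖ ^ 2 = ∫ x in Ioo 0 L, u' x ^ 2 * (L - x)⁻¹ := by
  rw [← real_inner_self_eq_norm_sq, inner_spaceH u u hu hu]
  simp only [pow_two]

theorem SpaceV.norm_def {L : ℝ} (u : SpaceV L) : ‖u‖ = ‖SpaceV.dxx u‖ := rfl

theorem norm_sq_muV {L : ℝ} (u : Lp ℝ 2 (muV L)) {z : ℝ → ℝ}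
    (hz : u =ᵐ[volume.restrict (Ioo 0 L)] z) :
    ‖u‖ ^ 2 = ∫ x in Ioo 0 L, z x ^ 2 * ((L - x) ^ 2)⁻¹ := by
  rw [← real_inner_self_eq_norm_sq, L2.inner_def, ← integral_muV]
  refine integral_congr_ae ((ae_muV_iff L).2 ?_)
  filter_upwards [hz] with x hx
  simp [hx, pow_two]

theorem SpaceV.dxx_ae_eq {L : ℝ} (u : SpaceV L) {z : ℝ → ℝ} (hz : HasWeakDeriv L 2 (toH u) z) :
    dxx u =ᵐ[volume.restrict (Ioo 0 L)] z := by
  obtain ⟨z', h1, h2⟩ := hasWeakDeriv_dxx u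
  exact h2.trans (h1.unique hz)

/-- The dissipation inequality. -/
theorem KawaharaGraph.energy {L β : ℝ} (hL : 0 < L) (hβ : -(3 / 80 : ℝ) < β) {u f : SpaceH L}
    (h : KawaharaGraph L β u f) :
    ∃ v : SpaceV L, SpaceV.toH v = u ∧
      inner ℝ f u + 1 / 20 * ‖v‖ ^ 2 ≤ 1 / 10 * ‖u‖ ^ 2 := by
  obtain ⟨u₀, u₁, u₂, u₃, u₄, r⟩ := h.exists_rep hL
  obtain ⟨hi, he⟩ := r.energy hL hβ ((memLp_two_coe f).integrable (by norm_num))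
  have d2 : HasWeakDeriv L 2 u u₂ :=
    ((r.prim₀.hasWeakDeriv L).succ (r.prim₁.hasWeakDeriv L)).congr r.ae_eq.symm
  have hz : MemLp u₂ 2 (muV L) := by
    have hm : AEStronglyMeasurable u₂ (muV L) :=
      aestronglyMeasurable_weightedMeasure r.prim₂.continuous.aestronglyMeasurable
    exact (memLp_two_iff_integrable_sq hm).2 ((integrable_muV_iff L _).2 hi)
  let v : SpaceV L := ⟨u, h.2.1, u₂, d2, hz⟩
  refine ⟨v, rfl, ?_⟩
  rw [SpaceV.norm_def, norm_sq_muV _ (SpaceV.dxx_ae_eq v d2), norm_sq_spaceH u r.ae_eq,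
    inner_spaceH f u ae_eq_rfl r.ae_eq]
  exact he

/-! ### The resolvent equation -/

theorem IsPrimitive.of_hasDerivAt {f g : ℝ → ℝ} (h : ∀ x, HasDerivAt f (g x) x)
    (hg : Continuous g) : IsPrimitive f g := by
  refine ⟨hg.locallyIntegrable, fun x => ?_⟩
  rw [intervalIntegral.integral_eq_sub_of_hasDerivAt (fun x _ => h x) (hg.intervalIntegrable _ _)]
  ring

theorem IsPrimitive.add {f g f' g' : ℝ → ℝ} (h : IsPrimitive f g) (h' : IsPrimitive f' g') :
    IsPrimitive (f + f') (g + g') := by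
  refine ⟨h.1.add h'.1, fun x => ?_⟩
  simp only [Pi.add_apply]
  rw [intervalIntegral.integral_add (h.1.intervalIntegrable _ _) (h'.1.intervalIntegrable _ _),
    h.2 x, h'.2 x]
  ring

/-! ### Linear systems with constant coefficients -/

section LinearODE

variable {E : Type*} [NormedAddCommGroup E] [NormedSpace ℝ E] [CompleteSpace E]

theorem hasDerivAt_exp_apply (A : E →L[ℝ] E) (y : E) (x : ℝ) :
    HasDerivAt (fun t : ℝ => NormedSpace.exp (t • A) y) (A (NormedSpace.exp (x • A) y)) x := by
  have := (hasDerivAt_exp_smul_const' (𝕂 := ℝ) A x).clm_apply (hasDerivAt_const x y)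
  simpa using this

/-- Duhamel's formula. -/
theorem exists_hasDerivAt_linear (A : E →L[ℝ] E) {b : ℝ → E} (hb : Continuous b) :
    ∃ z : ℝ → E, z 0 = 0 ∧ ∀ x, HasDerivAt z (A (z x) + b x) x := by
  have hc : Continuous fun s : ℝ => NormedSpace.exp ((-s) • A) (b s) := by
    have : Continuous fun s : ℝ => NormedSpace.exp ((-s) • A) :=
      (differentiable_exp_smul_const ℝ A).continuous.comp continuous_neg
    exact this.clm_apply hb
  refine ⟨fun x => NormedSpace.exp (x • A) (∫ s in (0 : ℝ)..x, NormedSpace.exp ((-s) • A) (b s)),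
    by simp, fun x => ?_⟩
  have h1 := intervalIntegral.integral_hasDerivAt_right (hc.intervalIntegrable 0 x)
    (hc.stronglyMeasurableAtFilter _ _) hc.continuousAt
  have h2 := (hasDerivAt_exp_smul_const' (𝕂 := ℝ) A x).clm_apply h1
  refine h2.congr_deriv ?_
  have e : NormedSpace.exp (x • A) * NormedSpace.exp ((-x) • A) = 1 := by
    let _ : NormedAlgebra ℚ (E →L[ℝ] E) := NormedAlgebra.restrictScalars ℚ ℝ _
    rw [← NormedSpace.exp_add_of_commute]
    · simp
    · exact ((Commute.refl A).smul_left x).smul_right (-x)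
  have e' : NormedSpace.exp (x • A) (NormedSpace.exp ((-x) • A) (b x)) = b x := by
    rw [← mul_apply_eq_comp, e]; rfl
  rw [e']
  rfl

end LinearODE

/-- The matrix of the first order system that is equivalent to `u⁗' = β u''' + l u`. -/
noncomputable def kawaharaSystem (β l : ℝ) : (Fin 5 → ℝ) →L[ℝ] (Fin 5 → ℝ) :=
  LinearMap.toContinuousLinearMap
    { toFun := fun y => ![y 1, y 2, y 3, y 4, β * y 3 + l * y 0]
      map_add' := fun y z => by
        ext i; fin_cases i <;> first | simp; done | (simp; ring)
      map_smul' := fun c y => by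
        ext i; fin_cases i <;> first | simp; done | (simp; ring) }

theorem kawaharaSystem_apply (β l : ℝ) (y : Fin 5 → ℝ) :
    kawaharaSystem β l y = ![y 1, y 2, y 3, y 4, β * y 3 + l * y 0] := rfl

/-- The boundary values of the solution of the homogeneous system. -/
noncomputable def boundaryMap (L β l : ℝ) : (Fin 5 → ℝ) →ₗ[ℝ] (Fin 5 → ℝ) where
  toFun y := ![y 0, y 1, NormedSpace.exp (L • kawaharaSystem β l) y 0,
    NormedSpace.exp (L • kawaharaSystem β l) y 1, NormedSpace.exp (L • kawaharaSystem β l) y 2]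
  map_add' y z := by
    ext i; fin_cases i <;> simp
  map_smul' c y := by
    ext i; fin_cases i <;> simp

/-- The representative that a solution of the first order system with a right-hand side gives. -/
theorem KawaharaRep.of_system {L β l : ℝ} {g G : ℝ → ℝ} (hG : IsPrimitive G g)
    {z : ℝ → Fin 5 → ℝ}
    (hz : ∀ x, HasDerivAt z (kawaharaSystem β l (z x) + ![0, 0, 0, G x, 0]) x)
    (h0 : z 0 0 = 0) (h1 : z 0 1 = 0) (hL0 : z L 0 = 0) (hL1 : z L 1 = 0) (hL2 : z L 2 = 0) :
    KawaharaRep L β (fun x => z x 0) (fun x => l * z x 0 + g x) (fun x => z x 0) (fun x => z x 1)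
      (fun x => z x 2) (fun x => z x 3) (fun x => z x 4 + G x) := by
  have hd := fun x => hasDerivAt_pi.1 (hz x)
  have hc : Continuous z := continuous_iff_continuousAt.2 fun x => (hz x).continuousAt
  have hci : ∀ i, Continuous fun x => z x i := fun i => (continuous_apply i).comp hc
  have hGc := hG.continuous
  have p0 : IsPrimitive (fun x => z x 0) (fun x => z x 1) :=
    .of_hasDerivAt (fun x => by simpa [kawaharaSystem_apply] using hd x 0) (hci 1)
  have p1 : IsPrimitive (fun x => z x 1) (fun x => z x 2) :=
    .of_hasDerivAt (fun x => by simpa [kawaharaSystem_apply] using hd x 1) (hci 2)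
  have p2 : IsPrimitive (fun x => z x 2) (fun x => z x 3) :=
    .of_hasDerivAt (fun x => by simpa [kawaharaSystem_apply] using hd x 2) (hci 3)
  -- The last unknown is `u₄ - G` rather than `u₄`. The merely integrable source `g` is thereby
  -- replaced by its continuous primitive `G`, and the system has classical solutions.
  have p3 : IsPrimitive (fun x => z x 3) (fun x => z x 4 + G x) :=
    .of_hasDerivAt (fun x => by simpa [kawaharaSystem_apply] using hd x 3) ((hci 4).add hGc)
  have p4 : IsPrimitive (fun x => z x 4) (fun x => β * z x 3 + l * z x 0) :=
    .of_hasDerivAt (fun x => by simpa [kawaharaSystem_apply] using hd x 4)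
      (((hci 3).const_mul β).add ((hci 0).const_mul l))
  refine ⟨ae_eq_rfl, p0, p1, p2, p3, ⟨_, p4.add hG, ?_⟩, h0, h1, hL0, hL1, hL2⟩
  filter_upwards with x
  simp only [Pi.add_apply]
  ring

/-- A kernel vector yields a solution of `A_β u = l u` with all five boundary conditions. The
dissipation inequality gives `l ‖u‖² ≤ (1/10) ‖u‖²`, so `u = 0`; then all its derivatives vanish on
`(0, L)`, and so does the initial vector by continuity. -/
theorem boundaryMap_injective {L β l : ℝ} (hL : 0 < L) (hβ : -(3 / 80 : ℝ) < β)
    (hl : 1 / 10 < l) : Function.Injective (boundaryMap L β l) := by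
  rw [injective_iff_map_eq_zero]
  intro y hy
  set z : ℝ → Fin 5 → ℝ := fun x => NormedSpace.exp (x • kawaharaSystem β l) y with hzdef
  have hz : ∀ x, HasDerivAt z (kawaharaSystem β l (z x)) x := hasDerivAt_exp_apply _ _
  have z0 : z 0 = y := by simp [hzdef]
  have hy' : ∀ i, ![y 0, y 1, z L 0, z L 1, z L 2] i = 0 := fun i => congrFun hy i
  have r := KawaharaRep.of_system (L := L) (β := β) (l := l) (G := 0) (g := 0) ⟨locallyIntegrable_zero, by simp⟩
    (z := z) (fun x => (hz x).congr_deriv (by ext i; fin_cases i <;> simp)) (by simpa [z0] using hy' 0) (by simpa [z0] using hy' 1)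
    (hy' 2) (hy' 3) (hy' 4)
  have c0 := r.prim₀.continuous
  obtain ⟨hi, he⟩ := r.energy hL hβ (by
    refine (IntegrableOn.mono_set ?_ Ioo_subset_Icc_self)
    exact ContinuousOn.integrableOn_Icc (by simpa using (c0.const_mul l).continuousOn))
  have i0 := r.integrableOn_sq
  have n2 : 0 ≤ ∫ x in Ioo 0 L, z x 2 ^ 2 * ((L - x) ^ 2)⁻¹ :=
    integral_nonneg fun x => by positivity
  have hpos : ∀ x ∈ Ioo 0 L, 0 ≤ z x 0 ^ 2 * (L - x)⁻¹ := fun x hx =>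
    mul_nonneg (sq_nonneg _) (inv_nonneg.2 (sub_nonneg.2 hx.2.le))
  have n0 : 0 ≤ ∫ x in Ioo 0 L, z x 0 ^ 2 * (L - x)⁻¹ := setIntegral_nonneg measurableSet_Ioo hpos
  have e1 : ∫ x in Ioo 0 L, (l * z x 0 + (0 : ℝ → ℝ) x) * z x 0 * (L - x)⁻¹ =
      l * ∫ x in Ioo 0 L, z x 0 ^ 2 * (L - x)⁻¹ := by
    rw [← integral_const_mul]
    congr 1
    ext x
    simp only [Pi.zero_apply]
    ring
  rw [e1] at he
  have e0 : ∫ x in Ioo 0 L, z x 0 ^ 2 * (L - x)⁻¹ = 0 := by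
    by_contra hne
    have := lt_of_le_of_ne n0 (Ne.symm hne)
    nlinarith
  rw [setIntegral_eq_zero_iff_of_nonneg_ae ((ae_restrict_iff' measurableSet_Ioo).2
    (Eventually.of_forall hpos)) i0] at e0
  have v0 : EqOn (fun x => z x 0) 0 (Ioo 0 L) := by
    refine Measure.eqOn_open_of_ae_eq (μ := volume) ?_ isOpen_Ioo c0.continuousOn continuousOn_const
    filter_upwards [e0, ae_restrict_mem measurableSet_Ioo] with x hx hx'
    have : (L - x)⁻¹ ≠ 0 := inv_ne_zero (sub_ne_zero.2 hx'.2.ne')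
    simpa [this] using hx
  have step : ∀ f g : ℝ → ℝ, (∀ x, HasDerivAt f (g x) x) → EqOn f 0 (Ioo 0 L) →
      EqOn g 0 (Ioo 0 L) := by
    intro f g hfg hf x hx
    have h1 : HasDerivAt f 0 x := (hasDerivAt_const x (0 : ℝ)).congr_of_eventuallyEq
      (by filter_upwards [isOpen_Ioo.mem_nhds hx] with t ht using hf ht)
    exact (hfg x).unique h1
  have hd := fun x => hasDerivAt_pi.1 (hz x)
  have v1 : EqOn (fun x => z x 1) 0 (Ioo 0 L) :=
    step _ _ (fun x => by simpa [kawaharaSystem_apply] using hd x 0) v0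
  have v2 : EqOn (fun x => z x 2) 0 (Ioo 0 L) :=
    step _ _ (fun x => by simpa [kawaharaSystem_apply] using hd x 1) v1
  have v3 : EqOn (fun x => z x 3) 0 (Ioo 0 L) :=
    step _ _ (fun x => by simpa [kawaharaSystem_apply] using hd x 2) v2
  have v4 : EqOn (fun x => z x 4) 0 (Ioo 0 L) :=
    step _ _ (fun x => by simpa [kawaharaSystem_apply] using hd x 3) v3
  have hc : Continuous z := continuous_iff_continuousAt.2 fun x => (hz x).continuousAt
  have hz0 : EqOn z 0 (Ioo 0 L) := by
    intro x hx
    ext i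
    fin_cases i
    exacts [v0 hx, v1 hx, v2 hx, v3 hx, v4 hx]
  have := hz0.of_subset_closure (t := Icc 0 L) hc.continuousOn continuousOn_const
    Ioo_subset_Icc_self (by rw [closure_Ioo hL.ne])
  rw [← z0]
  exact this ⟨le_rfl, hL.le⟩

/-- The resolvent equation is solvable. -/
theorem exists_kawaharaGraph {L β l : ℝ} (hL : 0 < L) (hβ : -(3 / 80 : ℝ) < β) (hl : 1 / 10 < l)
    (f : SpaceH L) : ∃ u : SpaceH L, KawaharaGraph L β u (l • u - f) := by
  have hf := (memLp_two_coe f).integrable (by norm_num)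
  have hg := (locallyIntegrable_indicator hf).neg
  set G : ℝ → ℝ := fun x => 0 + ∫ t in (0 : ℝ)..x, (-(Ioo 0 L).indicator f) t with hGdef
  have hG : IsPrimitive G _ := isPrimitive_integral hg 0
  obtain ⟨p, p0, hp⟩ := exists_hasDerivAt_linear (kawaharaSystem β l)
    (b := fun x => ![0, 0, 0, G x, 0]) (by
      refine continuous_pi fun i => ?_
      have := hG.continuous
      fin_cases i <;> simp <;> fun_prop)
  -- Shooting: in dimension five injectivity gives surjectivity, so a homogeneous solution can
  -- correct the end values of the particular solution `p`.
  obtain ⟨y, hy⟩ := (LinearMap.injective_iff_surjective.1 (boundaryMap_injective hL hβ hl))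
    ![0, 0, -p L 0, -p L 1, -p L 2]
  have hy' : ∀ i, boundaryMap L β l y i = ![0, 0, -p L 0, -p L 1, -p L 2] i := fun i => by rw [hy]
  set z : ℝ → Fin 5 → ℝ := fun x => NormedSpace.exp (x • kawaharaSystem β l) y + p x with hzdef
  have z0 : z 0 = y := by simp [hzdef, p0]
  have r := KawaharaRep.of_system (L := L) hG (z := z) (l := l) (β := β)
    (fun x => ((hasDerivAt_exp_apply _ y x).add (hp x)).congr_deriv (by
      simp only [hzdef, map_add]; abel))
    (by simpa [z0, boundaryMap] using hy' 0) (by simpa [z0, boundaryMap] using hy' 1)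
    (by have := hy' 2; simp [boundaryMap] at this; simp [hzdef, this])
    (by have := hy' 3; simp [boundaryMap] at this; simp [hzdef, this])
    (by have := hy' 4; simp [boundaryMap] at this; simp [hzdef, this])
  have hm : AEStronglyMeasurable (fun x => z x 0) (muH L) :=
    aestronglyMeasurable_weightedMeasure r.prim₀.continuous.aestronglyMeasurable
  have hu : MemLp (fun x => z x 0) 2 (muH L) :=
    (memLp_two_iff_integrable_sq hm).2 ((integrable_muH_iff L _).2 r.integrableOn_sq)
  have e1 : hu.toLp =ᵐ[volume.restrict (Ioo 0 L)] fun x => z x 0 :=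
    (ae_eq_muH_iff L).1 hu.coeFn_toLp
  have e2 : (l • hu.toLp - f : SpaceH L) =ᵐ[volume.restrict (Ioo 0 L)]
      fun x => l * z x 0 + (-(Ioo 0 L).indicator f) x := by
    have a1 := (ae_eq_muH_iff L).1 (Lp.coeFn_sub (l • hu.toLp) f)
    have a2 := (ae_eq_muH_iff L).1 (Lp.coeFn_smul l hu.toLp)
    filter_upwards [a1, a2, e1, ae_restrict_mem measurableSet_Ioo] with x b1 b2 b3 b4
    rw [b1, Pi.sub_apply, b2, Pi.smul_apply, b3, Pi.neg_apply, indicator_of_mem b4, smul_eq_mul]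
    ring
  refine ⟨hu.toLp, KawaharaRep.kawaharaGraph hL (u₀ := fun x => z x 0) (u₁ := fun x => z x 1)
    (u₂ := fun x => z x 2) (u₃ := fun x => z x 3) (u₄ := fun x => z x 4 + G x) ?_⟩
  obtain ⟨h, h4, h4'⟩ := r.prim₄
  refine { r with ae_eq := e1, prim₄ := ⟨h, h4, ?_⟩ }
  filter_upwards [h4', e2] with x b1 b2
  rw [b1, b2]

/-! ### Completeness of `V` and the embedding of `V` in `H` -/

theorem integrableOn_coe_muV {L : ℝ} (z : Lp ℝ 2 (muV L)) : IntegrableOn z (Ioo 0 L) :=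
  (MemLp.restrict_of_muV (Lp.memLp z)).integrable (by norm_num)

/-- Hölder's inequality on the bounded interval, with the weight bounded below by `L⁻²`. This makes
primitives of `u_xx` depend continuously, in the uniform norm, on `u` in `V`. -/
theorem exists_integral_abs_le (L : ℝ) :
    ∃ C : ℝ, 0 ≤ C ∧ ∀ z : Lp ℝ 2 (muV L), ∫ x in Ioo 0 L, |z x| ≤ C * ‖z‖ := by
  set c : ℝ≥0∞ := ENNReal.ofReal (L ^ 2) ^ (1 / (2 : ℝ≥0∞)).toReal *
    (volume.restrict (Ioo 0 L)) univ ^ (1 / (1 : ℝ≥0∞).toReal - 1 / (2 : ℝ≥0∞).toReal) with hc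
  have hctop : c ≠ ⊤ := by
    refine ENNReal.mul_ne_top (ENNReal.rpow_ne_top_of_nonneg (by simp) ENNReal.ofReal_ne_top)
      (ENNReal.rpow_ne_top_of_nonneg (by norm_num) (by simp))
  refine ⟨c.toReal, ENNReal.toReal_nonneg, fun z => ?_⟩
  have hm : AEStronglyMeasurable z (volume.restrict (Ioo 0 L)) :=
    (integrableOn_coe_muV z).aestronglyMeasurable
  have h1 := eLpNorm_le_eLpNorm_mul_rpow_measure_univ (p := 1) (q := 2) (by norm_num) hm
  have h2 : eLpNorm z 2 (volume.restrict (Ioo 0 L)) ≤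
      ENNReal.ofReal (L ^ 2) ^ (1 / (2 : ℝ≥0∞)).toReal * eLpNorm z 2 (muV L) := by
    refine (eLpNorm_mono_measure _ (restrict_le_weightedMeasure L 2)).trans ?_
    rw [eLpNorm_smul_measure_of_ne_top (by norm_num), smul_eq_mul]
    rfl
  have h3 : eLpNorm z 1 (volume.restrict (Ioo 0 L)) ≤ c * eLpNorm z 2 (muV L) := by
    refine h1.trans ((mul_le_mul_left h2 _).trans (le_of_eq ?_))
    rw [hc]; ring
  have h4 := ENNReal.toReal_mono (ENNReal.mul_ne_top hctop (Lp.eLpNorm_ne_top z)) h3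
  rw [ENNReal.toReal_mul, ← Lp.norm_def] at h4
  refine le_trans (le_of_eq ?_) h4
  rw [eLpNorm_one_eq_lintegral_enorm, ← integral_norm_eq_lintegral_enorm hm]
  rfl

/-- The primitive of `z` on `(0, L)` that vanishes at `0`. -/
noncomputable def primitiveOn (L : ℝ) (z : ℝ → ℝ) (x : ℝ) : ℝ :=
  0 + ∫ t in (0 : ℝ)..x, (Ioo 0 L).indicator z t

theorem isPrimitive_primitiveOn {L : ℝ} {z : ℝ → ℝ} (hz : IntegrableOn z (Ioo 0 L)) :
    IsPrimitive (primitiveOn L z) ((Ioo 0 L).indicator z) :=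
  isPrimitive_integral (locallyIntegrable_indicator hz) 0

theorem primitiveOn_zero (L : ℝ) (z : ℝ → ℝ) : primitiveOn L z 0 = 0 := by
  simp [primitiveOn]

theorem abs_primitiveOn_le {L : ℝ} {z : ℝ → ℝ} (hz : IntegrableOn z (Ioo 0 L)) {x : ℝ}
    (hx : x ∈ Icc 0 L) : |primitiveOn L z x| ≤ ∫ t in Ioo 0 L, |z t| := by
  have hi := locallyIntegrable_indicator hz
  rw [primitiveOn, zero_add]
  refine (intervalIntegral.abs_integral_le_integral_abs hx.1).trans ?_
  have hi' := hi.intervalIntegrable 0 L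
  calc ∫ t in (0 : ℝ)..x, |(Ioo 0 L).indicator z t|
      ≤ ∫ t in (0 : ℝ)..L, |(Ioo 0 L).indicator z t| := by
        refine intervalIntegral.integral_mono_interval le_rfl hx.1 hx.2
          (Eventually.of_forall fun t => abs_nonneg _) hi'.abs
    _ = ∫ t in Ioo 0 L, |z t| := by
        rw [intervalIntegral.integral_of_le (hx.1.trans hx.2), integral_Ioc_eq_integral_Ioo]
        refine setIntegral_congr_fun measurableSet_Ioo fun t ht => ?_
        simp only [indicator_of_mem ht]

theorem primitiveOn_sub {L : ℝ} {z z' w : ℝ → ℝ} (hz : IntegrableOn z (Ioo 0 L))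
    (hz' : IntegrableOn z' (Ioo 0 L)) (hw : w =ᵐ[volume.restrict (Ioo 0 L)] z - z') (x : ℝ) :
    primitiveOn L w x = primitiveOn L z x - primitiveOn L z' x := by
  have hi := (locallyIntegrable_indicator hz).intervalIntegrable 0 x
  have hi' := (locallyIntegrable_indicator hz').intervalIntegrable 0 x
  simp only [primitiveOn, zero_add]
  rw [← intervalIntegral.integral_sub hi hi']
  refine intervalIntegral.integral_congr_ae ?_
  filter_upwards [(ae_restrict_iff' measurableSet_Ioo).1 hw] with t ht _
  by_cases h : t ∈ Ioo 0 L
  · simp only [indicator_of_mem h, ht h, Pi.sub_apply]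
  · simp only [indicator_of_notMem h, sub_zero]

/-- The regular representative of an element of `V`. -/
theorem SpaceV.exists_rep {L : ℝ} (hL : 0 < L) (u : SpaceV L) :
    ∃ u₀ : ℝ → ℝ, toH u =ᵐ[volume.restrict (Ioo 0 L)] u₀ ∧
      IsPrimitive u₀ (primitiveOn L (dxx u)) ∧ u₀ 0 = 0 ∧ u₀ L = 0 ∧
      primitiveOn L (dxx u) L = 0 := by
  obtain ⟨z, hz, hz'⟩ := hasWeakDeriv_dxx u
  obtain ⟨-, t0, tL, w1, hw1, t10, t1L⟩ := u.2.1
  have hi := integrableOn_coe_muV (dxx u)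
  obtain ⟨u1, p1, e1⟩ := (hw1.of_succ hz).exists_isPrimitive hL (locallyIntegrable_indicator hi)
    (hz'.symm.trans (indicator_ae_eq_Ioo _))
  have h0 : (0 : ℝ) ∈ Icc 0 L := ⟨le_rfl, hL.le⟩
  have h1 : L ∈ Icc 0 L := ⟨hL.le, le_rfl⟩
  have e : u1 = primitiveOn L (dxx u) := by
    ext x
    rw [p1.2 x, (hasZeroTrace_iff hL h0 p1.continuous e1).1 t10, primitiveOn]
  obtain ⟨u0, p0, e0⟩ := hw1.exists_isPrimitive hL p1.continuous.locallyIntegrable e1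
  rw [e] at p0 p1 e1
  exact ⟨u0, e0, p0, (hasZeroTrace_iff hL h0 p0.continuous e0).1 t0,
    (hasZeroTrace_iff hL h1 p0.continuous e0).1 tL,
    (hasZeroTrace_iff hL h1 p1.continuous e1).1 t1L⟩

theorem IsPrimitive.abs_le_of_primitiveOn {L : ℝ} {z u₀ : ℝ → ℝ} (hz : IntegrableOn z (Ioo 0 L))
    (p : IsPrimitive u₀ (primitiveOn L z)) (h : u₀ L = 0) :
    ∀ x ∈ Icc 0 L, |u₀ x| ≤ (∫ t in Ioo 0 L, |z t|) * (L - x) := by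
  intro x hx
  have := p.abs_le (n := 0) h (integral_nonneg fun t => abs_nonneg _)
    (fun x hx => by simpa using abs_primitiveOn_le hz hx) x hx
  simpa using this

theorem sq_mul_weight_le {L I x v : ℝ} (hx : x ∈ Ioo 0 L) (hv : |v| ≤ I * (L - x)) :
    |v ^ 2 * (L - x)⁻¹| ≤ I ^ 2 * L := by
  have hy : 0 < L - x := sub_pos.2 hx.2
  have h1 : L - x ≤ L := by linarith [hx.1]
  rw [abs_mul, abs_pow, abs_of_pos (inv_pos.2 hy), ← div_eq_mul_inv, div_le_iff₀ hy]
  calc |v| ^ 2 ≤ (I * (L - x)) ^ 2 := pow_le_pow_left₀ (abs_nonneg _) hv 2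
    _ = I ^ 2 * (L - x) * (L - x) := by ring
    _ ≤ I ^ 2 * L * (L - x) := by gcongr

/-- Since `|u_x| ≤ ∫ |u_xx|` and `u(L) = 0`, one has `|u| ≤ (L - x) ∫ |u_xx|`, which beats the
weight `(L - x)⁻¹`. -/
theorem SpaceV.exists_norm_toH_le {L : ℝ} (hL : 0 < L) :
    ∃ C : ℝ, ∀ u : SpaceV L, ‖toH u‖ ≤ C * ‖u‖ := by
  obtain ⟨C, hC0, hC⟩ := exists_integral_abs_le L
  refine ⟨L * C, fun u => ?_⟩
  obtain ⟨u0, e0, p0, -, hL0, -⟩ := u.exists_rep hL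
  have hb := p0.abs_le_of_primitiveOn (integrableOn_coe_muV (dxx u)) hL0
  set I := ∫ t in Ioo 0 L, |dxx u t| with hI
  have hI0 : 0 ≤ I := integral_nonneg fun t => abs_nonneg _
  have h1 : ‖toH u‖ ^ 2 ≤ (L * I) ^ 2 := by
    rw [norm_sq_spaceH _ e0]
    have := norm_setIntegral_le_of_norm_le_const (μ := volume) (s := Ioo 0 L) (C := I ^ 2 * L)
      (f := fun x => u0 x ^ 2 * (L - x)⁻¹) (by simp)
      (fun x hx => sq_mul_weight_le hx (hb x (Ioo_subset_Icc_self hx)))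
    refine (le_abs_self _).trans (this.trans (le_of_eq ?_))
    simp only [Measure.real, Real.volume_Ioo, sub_zero, ENNReal.toReal_ofReal hL.le]
    ring
  have h2 : ‖toH u‖ ≤ L * I := (sq_le_sq₀ (norm_nonneg _) (by positivity)).1 h1
  calc ‖toH u‖ ≤ L * I := h2
    _ ≤ L * (C * ‖u‖) := by
        have := hC (dxx u)
        rw [SpaceV.norm_def]
        gcongr
    _ = L * C * ‖u‖ := by ring

/-- Integrating `z` twice from `0` takes care of the conditions at `0`; the two hypotheses are
`u_x(L) = 0` and `u(L) = 0`. They describe the range of `dxx`. -/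
theorem SpaceV.exists_dxx_eq {L : ℝ} (hL : 0 < L) (z : Lp ℝ 2 (muV L))
    (h1 : primitiveOn L z L = 0) (h0 : ∫ t in (0 : ℝ)..L, primitiveOn L z t = 0) :
    ∃ v : SpaceV L, dxx v = z := by
  have hi := integrableOn_coe_muV z
  have p1 := isPrimitive_primitiveOn hi
  have p0 := isPrimitive_integral p1.continuous.locallyIntegrable 0
  set u0 : ℝ → ℝ := fun x => 0 + ∫ t in (0 : ℝ)..x, primitiveOn L z t with hu0
  have u00 : u0 0 = 0 := by simp [hu0]
  have u0L : u0 L = 0 := by simp [hu0, h0]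
  have hb := p0.abs_le_of_primitiveOn hi u0L
  have hm : AEStronglyMeasurable u0 (muH L) :=
    aestronglyMeasurable_weightedMeasure p0.continuous.aestronglyMeasurable
  have hu : MemLp u0 2 (muH L) :=
    (memLp_two_iff_integrable_sq hm).2 ((integrable_muH_iff L _).2
      (integrableOn_Ioo_of_bound ((p0.continuous.continuousOn.pow 2).mul (continuousOn_weight L))
        (fun x hx => sq_mul_weight_le hx (hb x (Ioo_subset_Icc_self hx)))))
  have e : u0 =ᵐ[volume.restrict (Ioo 0 L)] hu.toLp :=
    ((ae_eq_muH_iff L).1 hu.coeFn_toLp).symm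
  have d1 := (p0.hasWeakDeriv L).congr e
  have d2 := d1.succ ((p1.hasWeakDeriv L).congr_right (indicator_ae_eq_Ioo _).symm)
  have hS : MemSobolev L 2 hu.toLp := by
    intro k hk
    interval_cases k
    · exact ⟨_, .zero d1.1, memLp_two_coe _⟩
    · exact ⟨_, d1, memLp_two_of_continuous p1.continuous⟩
    · exact ⟨z, d2, MemLp.restrict_of_muV (Lp.memLp z)⟩
  have m0 : (0 : ℝ) ∈ Icc 0 L := ⟨le_rfl, hL.le⟩
  have m1 : L ∈ Icc 0 L := ⟨hL.le, le_rfl⟩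
  let v : SpaceV L := ⟨hu.toLp, ⟨hS, (hasZeroTrace_iff hL m0 p0.continuous e.symm).2 u00,
    (hasZeroTrace_iff hL m1 p0.continuous e.symm).2 u0L, _, d1,
    (hasZeroTrace_iff hL m0 p1.continuous ae_eq_rfl).2 (primitiveOn_zero L z),
    (hasZeroTrace_iff hL m1 p1.continuous ae_eq_rfl).2 h1⟩, z, d2, Lp.memLp z⟩
  exact ⟨v, Lp.ext ((ae_eq_muV_iff L).2 (SpaceV.dxx_ae_eq v d2))⟩

theorem SpaceV.isometry_dxx (L : ℝ) : Isometry (dxx : SpaceV L → Lp ℝ 2 (muV L)) :=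
  AddMonoidHomClass.isometry_of_norm _ fun _ => rfl

/-- `dxx` is an isometry whose range is cut out by two linear conditions that are continuous by the
`L¹` bound, hence closed under limits. -/
theorem SpaceV.completeSpace {L : ℝ} (hL : 0 < L) : CompleteSpace (SpaceV L) := by
  obtain ⟨C, hC0, hC⟩ := exists_integral_abs_le L
  refine Metric.complete_of_cauchySeq_tendsto fun u hu => ?_
  have hu' : CauchySeq fun n => dxx (u n) :=
    hu.map (isometry_dxx L).uniformContinuous
  obtain ⟨z, hz⟩ := cauchySeq_tendsto_of_complete hu'
  have hlim : Tendsto (fun n => C * ‖dxx (u n) - z‖) atTop (𝓝 0) := by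
    have := (tendsto_iff_norm_sub_tendsto_zero.1 hz).const_mul C
    rwa [mul_zero] at this
  have hdiff : ∀ n, ∀ x ∈ Icc 0 L,
      |primitiveOn L (dxx (u n)) x - primitiveOn L z x| ≤ C * ‖dxx (u n) - z‖ := by
    intro n x hx
    rw [← primitiveOn_sub (integrableOn_coe_muV _) (integrableOn_coe_muV _)
      ((ae_eq_muV_iff L).1 (Lp.coeFn_sub (dxx (u n)) z))]
    exact (abs_primitiveOn_le (integrableOn_coe_muV _) hx).trans (hC _)
  have h1 : primitiveOn L z L = 0 := by
    refine abs_eq_zero.1 (le_antisymm (ge_of_tendsto' hlim fun n => ?_) (abs_nonneg _))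
    obtain ⟨u0, -, -, -, -, hL1⟩ := (u n).exists_rep hL
    have := hdiff n L ⟨hL.le, le_rfl⟩
    rwa [hL1, zero_sub, abs_neg] at this
  have h0 : ∫ t in (0 : ℝ)..L, primitiveOn L z t = 0 := by
    have hlim' := hlim.mul_const L
    rw [zero_mul] at hlim'
    refine abs_eq_zero.1 (le_antisymm (ge_of_tendsto' hlim' fun n => ?_) (abs_nonneg _))
    obtain ⟨u0, -, p0, u00, uL, -⟩ := (u n).exists_rep hL
    have e := p0.integral_eq_sub 0 L
    rw [u00, uL, sub_zero] at e
    have c1 := (isPrimitive_primitiveOn (integrableOn_coe_muV (dxx (u n)))).continuous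
    have c2 := (isPrimitive_primitiveOn (integrableOn_coe_muV z)).continuous
    have e2 : ∫ t in (0 : ℝ)..L, (primitiveOn L (dxx (u n)) t - primitiveOn L z t) =
        -∫ t in (0 : ℝ)..L, primitiveOn L z t := by
      rw [intervalIntegral.integral_sub (c1.intervalIntegrable _ _) (c2.intervalIntegrable _ _), e,
        zero_sub]
    rw [← abs_neg, ← e2]
    have := intervalIntegral.norm_integral_le_of_norm_le_const (a := 0) (b := L)
      (f := fun t => primitiveOn L (dxx (u n)) t - primitiveOn L z t)
      (C := C * ‖dxx (u n) - z‖) fun t ht => by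
        rw [uIoc_of_le hL.le] at ht
        exact hdiff n t ⟨ht.1.le, ht.2⟩
    rwa [sub_zero, abs_of_pos hL] at this
  obtain ⟨v, hv⟩ := exists_dxx_eq hL z h1 h0
  refine ⟨v, ?_⟩
  rw [← hv] at hz
  exact (isometry_dxx L).isEmbedding.tendsto_nhds_iff.2 hz

/-! ### Generation of semigroups by maximal dissipative operators -/

/-- The graph `A` is the graph of a linear operator such that `A - K` is maximal dissipative. -/
structure IsMaximalDissipative {X : Type*} [NormedAddCommGroup X] [InnerProductSpace ℝ X]
    (A : X → X → Prop) (K : ℝ) : Prop where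
  add : ∀ {x y x' y' : X}, A x y → A x' y' → A (x + x') (y + y')
  smul : ∀ (c : ℝ) {x y : X}, A x y → A (c • x) (c • y)
  unique : ∀ {x y y' : X}, A x y → A x y' → y = y'
  dissipative : ∀ {x y : X}, A x y → inner ℝ y x ≤ K * ‖x‖ ^ 2
  range : ∀ l : ℝ, K < l → ∀ f : X, ∃ u : X, A u (l • u - f)

namespace IsMaximalDissipative

variable {X : Type*} [NormedAddCommGroup X] [InnerProductSpace ℝ X] {A : X → X → Prop} {K : ℝ}

theorem sub (hA : IsMaximalDissipative A K) {x y x' y' : X} (h : A x y) (h' : A x' y') :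
    A (x - x') (y - y') := by
  simpa [sub_eq_add_neg] using hA.add h (hA.smul (-1) h')

theorem norm_le (hA : IsMaximalDissipative A K) {l : ℝ} {u f : X}
    (h : A u (l • u - f)) : (l - K) * ‖u‖ ≤ ‖f‖ := by
  rcases (norm_nonneg u).eq_or_lt with h0 | h0
  · rw [← h0, mul_zero]; exact norm_nonneg f
  have h1 := hA.dissipative h
  rw [inner_sub_left, inner_smul_left, real_inner_self_eq_norm_sq] at h1
  have h2 := real_inner_le_norm f u
  simp only [conj_trivial] at h1
  refine le_of_mul_le_mul_right ?_ h0
  nlinarith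

theorem eq_of_graph (hA : IsMaximalDissipative A K) {l : ℝ} (hl : K < l) {u u' f : X}
    (h : A u (l • u - f)) (h' : A u' (l • u' - f)) : u = u' := by
  have h1 : A (u - u') (l • (u - u') - 0) := by
    convert hA.sub h h' using 1
    rw [smul_sub]; abel
  have h2 := hA.norm_le h1
  rw [norm_zero] at h2
  have h3 : ‖u - u'‖ ≤ 0 := nonpos_of_mul_nonpos_right h2 (sub_pos.2 hl)
  exact sub_eq_zero.1 (norm_le_zero_iff.1 h3)

/-- The resolvent `(l - A)⁻¹`. -/
theorem exists_resolvent (hA : IsMaximalDissipative A K) {l : ℝ} (hl : K < l) :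
    ∃ J : X →L[ℝ] X, (∀ f, A (J f) (l • J f - f)) ∧ ∀ f, ‖J f‖ ≤ (l - K)⁻¹ * ‖f‖ := by
  choose J hJ using hA.range l hl
  have hb : ∀ f, ‖J f‖ ≤ (l - K)⁻¹ * ‖f‖ := fun f => by
    rw [inv_mul_eq_div, le_div_iff₀ (sub_pos.2 hl), mul_comm]
    exact hA.norm_le (hJ f)
  let J' : X →ₗ[ℝ] X :=
    { toFun := J
      map_add' := fun f g => by
        refine hA.eq_of_graph hl (hJ (f + g)) ?_
        convert hA.add (hJ f) (hJ g) using 1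
        rw [smul_add]; abel
      map_smul' := fun c f => by
        have := hA.smul c (hJ f)
        rw [smul_sub, smul_comm] at this
        exact hA.eq_of_graph hl (hJ (c • f)) this }
  exact ⟨J'.mkContinuous _ hb, hJ, hb⟩

/-- If `x` is orthogonal to the domain, solve `(K + 1) u - A u = x` and pair with `u`: dissipativity
forces `u = 0`, hence `x = 0`. -/
theorem dense_domain (hA : IsMaximalDissipative A K) [CompleteSpace X] :
    Dense {x | ∃ y, A x y} := by
  obtain ⟨u0, hu0⟩ := hA.range (K + 1) (by linarith) 0
  have hzero : A 0 0 := by simpa using hA.smul 0 hu0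
  let D : Submodule ℝ X :=
    { carrier := {x | ∃ y, A x y}
      add_mem' := fun ⟨y, h⟩ ⟨y', h'⟩ => ⟨y + y', hA.add h h'⟩
      zero_mem' := ⟨0, hzero⟩
      smul_mem' := fun c _ ⟨y, h⟩ => ⟨c • y, hA.smul c h⟩ }
  change Dense (D : Set X)
  rw [Submodule.dense_iff_topologicalClosure_eq_top, Submodule.topologicalClosure_eq_top_iff,
    Submodule.eq_bot_iff]
  intro x hx
  obtain ⟨u, hu⟩ := hA.range (K + 1) (by linarith) x
  have h1 : inner ℝ x u = 0 := by
    rw [real_inner_comm]; exact (Submodule.mem_orthogonal D x).1 hx u ⟨_, hu⟩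
  have h2 := hA.dissipative hu
  rw [inner_sub_left, inner_smul_left, real_inner_self_eq_norm_sq, h1] at h2
  simp only [conj_trivial] at h2
  have h3 : ‖u‖ ^ 2 = 0 := le_antisymm (by linarith) (sq_nonneg _)
  have h4 : u = 0 := norm_eq_zero.1 (by simpa using h3)
  rw [h4] at hu
  simpa using hA.unique hu hzero

end IsMaximalDissipative

/-! ### Exponentials of bounded operators with a one-sided bound -/

section ExpGrowth

variable {X : Type*} [NormedAddCommGroup X] [InnerProductSpace ℝ X] [CompleteSpace X]

/-- Gronwall's argument: `exp(-2κt) ‖exp(tY) x‖²` is nonincreasing. The bound involves `κ` only, not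
`‖Y‖`, as is needed for the unbounded limit. -/
theorem norm_exp_smul_apply_le {Y : X →L[ℝ] X} {κ : ℝ}
    (hY : ∀ x, inner ℝ (Y x) x ≤ κ * ‖x‖ ^ 2) {t : ℝ} (ht : 0 ≤ t) (x : X) :
    ‖NormedSpace.exp (t • Y) x‖ ≤ Real.exp (κ * t) * ‖x‖ := by
  set v : ℝ → X := fun t => NormedSpace.exp (t • Y) x with hv
  have hd : ∀ t, HasDerivAt (fun t => Real.exp (-(2 * κ) * t) * ‖v t‖ ^ 2)
      (Real.exp (-(2 * κ) * t) * (2 * inner ℝ (Y (v t)) (v t) - 2 * (κ * ‖v t‖ ^ 2))) t := by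
    intro t
    have h1 := (hasDerivAt_exp_apply Y x t).norm_sq
    have h2 := ((hasDerivAt_id t).const_mul (-(2 * κ))).exp
    refine (h2.fun_mul h1).congr_deriv ?_
    rw [real_inner_comm]
    simp only [id, hv]
    ring
  have hanti : Antitone fun t => Real.exp (-(2 * κ) * t) * ‖v t‖ ^ 2 := by
    refine antitone_of_hasDerivAt_nonpos hd fun t => ?_
    refine mul_nonpos_of_nonneg_of_nonpos (Real.exp_pos _).le ?_
    linarith [hY (v t)]
  have h0 := hanti ht
  have hv0 : v 0 = x := by simp [hv]
  simp only [mul_zero, Real.exp_zero, one_mul, hv0] at h0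
  refine (sq_le_sq₀ (norm_nonneg _) (by positivity)).1 ?_
  have e : (Real.exp (κ * t) * ‖x‖) ^ 2 = Real.exp (2 * κ * t) * ‖x‖ ^ 2 := by
    rw [mul_pow, ← Real.exp_nat_mul]; push_cast; ring_nf
  have e2 : ‖v t‖ ^ 2 = Real.exp (2 * κ * t) * (Real.exp (-(2 * κ) * t) * ‖v t‖ ^ 2) := by
    rw [← mul_assoc, ← Real.exp_add]
    ring_nf
    simp
  rw [e]
  change ‖v t‖ ^ 2 ≤ _
  rw [e2]
  exact mul_le_mul_of_nonneg_left h0 (Real.exp_pos _).le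

/-- The path `s ↦ exp((t - s)Z) exp(sY) x` joins the two exponentials. By commutation its derivative
is `exp((t - s)Z) exp(sY) (Y x - Z x)`. -/
theorem norm_exp_sub_exp_le {Y Z : X →L[ℝ] X} {κ : ℝ} (hc : Commute Y Z)
    (hY : ∀ x, inner ℝ (Y x) x ≤ κ * ‖x‖ ^ 2) (hZ : ∀ x, inner ℝ (Z x) x ≤ κ * ‖x‖ ^ 2) {t : ℝ}
    (ht : 0 ≤ t) (x : X) :
    ‖NormedSpace.exp (t • Y) x - NormedSpace.exp (t • Z) x‖ ≤
      t * Real.exp (κ * t) * ‖Y x - Z x‖ := by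
  let _ : NormedAlgebra ℚ (X →L[ℝ] X) := NormedAlgebra.restrictScalars ℚ ℝ _
  have hcm : ∀ s : ℝ, Commute (NormedSpace.exp (s • Y)) Z := fun s => (hc.smul_left s).exp_left
  set φ : ℝ → X := fun s => NormedSpace.exp ((t - s) • Z) (NormedSpace.exp (s • Y) x)
  have hφ : ∀ s, HasDerivAt φ
      (NormedSpace.exp ((t - s) • Z) (NormedSpace.exp (s • Y) (Y x - Z x))) s := by
    intro s
    have h1 : HasDerivAt (fun s : ℝ => NormedSpace.exp ((t - s) • Z))
        (-(NormedSpace.exp ((t - s) • Z) * Z)) s := by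
      exact ((hasDerivAt_exp_smul_const (𝕂 := ℝ) Z (t - s)).scomp s
        ((hasDerivAt_id s).const_sub t)).congr_deriv (neg_one_smul ℝ _)
    have h2 : HasDerivAt (fun s : ℝ => NormedSpace.exp (s • Y) x)
        (NormedSpace.exp (s • Y) (Y x)) s := by
      have := (hasDerivAt_exp_smul_const (𝕂 := ℝ) Y s).clm_apply (hasDerivAt_const s x)
      simpa using this
    refine (h1.clm_apply h2).congr_deriv ?_
    have e : Z (NormedSpace.exp (s • Y) x) = NormedSpace.exp (s • Y) (Z x) :=
      (DFunLike.congr_fun (hcm s).eq x).symm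
    simp only [neg_apply, mul_apply_eq_comp, e, map_sub]
    abel
  have hb := norm_image_sub_le_of_norm_deriv_le_segment' (f := φ) (a := 0) (b := t)
    (C := Real.exp (κ * t) * ‖Y x - Z x‖) (fun s _ => (hφ s).hasDerivWithinAt)
    (fun s hs => by
      refine (norm_exp_smul_apply_le hZ (sub_nonneg.2 hs.2.le) _).trans ?_
      have := norm_exp_smul_apply_le hY hs.1 (Y x - Z x)
      refine (mul_le_mul_of_nonneg_left this (Real.exp_pos _).le).trans (le_of_eq ?_)
      rw [← mul_assoc, ← Real.exp_add]
      ring_nf) t ⟨ht, le_rfl⟩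
  simp only [φ, sub_self, zero_smul, NormedSpace.exp_zero, sub_zero] at hb
  refine hb.trans (le_of_eq ?_)
  ring

end ExpGrowth

/-! ### Yosida approximation -/

namespace IsMaximalDissipative

variable {X : Type*} [NormedAddCommGroup X] [InnerProductSpace ℝ X] [CompleteSpace X]
  {A : X → X → Prop} {K : ℝ}

/-- The Yosida approximations. -/
theorem exists_yosida (hA : IsMaximalDissipative A K) (hK : 0 ≤ K) :
    ∃ Y : ℕ → X →L[ℝ] X, (∀ n m, Commute (Y n) (Y m)) ∧
      (∀ n x, inner ℝ (Y n x) x ≤ 4 * K * ‖x‖ ^ 2) ∧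
      ∀ x y, A x y → Tendsto (fun n => Y n x) atTop (𝓝 y) := by
  -- The shift gives `l ≤ 2 (l - K)`, hence the uniform bound `‖l J‖ ≤ 2`.
  set l : ℕ → ℝ := fun n => n + (2 * K + 1) with hl
  have hlK : ∀ n, K < l n := fun n => by
    have : (0 : ℝ) ≤ n := n.cast_nonneg
    simp only [hl]; linarith
  have hl2 : ∀ n, l n ≤ 2 * (l n - K) := fun n => by
    have : (0 : ℝ) ≤ n := n.cast_nonneg
    simp only [hl]; linarith
  have hl0 : ∀ n, 0 < l n := fun n => hK.trans_lt (hlK n)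
  choose J hJ hJb using fun n => hA.exists_resolvent (hlK n)
  -- The resolvent identity, from which the resolvents commute.
  have hres : ∀ n m f, J n f = J m f + (l m - l n) • J m (J n f) := by
    intro n m f
    have h1 : A (J n f) (l m • J n f - (f + (l m - l n) • J n f)) := by
      have e : l m • J n f - (f + (l m - l n) • J n f) = l n • J n f - f := by
        rw [sub_smul]; abel
      rw [e]; exact hJ n f
    rw [← map_smul, ← map_add]
    exact hA.eq_of_graph (hlK m) h1 (hJ m _)
  have hcomm : ∀ n m, Commute (J n) (J m) := by
    intro n m
    rcases eq_or_ne (l m) (l n) with h | h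
    · have : n = m := by simpa [hl] using h.symm
      rw [this]
    · ext f
      have h1 := hres n m f
      have h2 := hres m n f
      have h3 : (l m - l n) • (J m (J n f) - J n (J m f)) = 0 := by
        rw [smul_sub, sub_eq_zero]
        have e1 : (l m - l n) • J m (J n f) = J n f - J m f := by
          rw [eq_sub_iff_add_eq, add_comm]; exact h1.symm
        have e2 : (l n - l m) • J n (J m f) = J m f - J n f := by
          rw [eq_sub_iff_add_eq, add_comm]; exact h2.symm
        rw [e1, ← neg_sub (l n) (l m), neg_smul, e2, neg_sub]
      rcases smul_eq_zero.1 h3 with h4 | h4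
      · exact absurd (sub_eq_zero.1 h4) h
      · exact (sub_eq_zero.1 h4).symm
  have hlJ : ∀ n z, ‖l n • J n z‖ ≤ 2 * ‖z‖ := by
    intro n z
    have h1 := hA.norm_le (hJ n z)
    rw [norm_smul, Real.norm_of_nonneg (hl0 n).le]
    have h2 := mul_le_mul_of_nonneg_right (hl2 n) (norm_nonneg (J n z))
    linarith
  have hltop : Tendsto (fun n => (l n - K)⁻¹) atTop (𝓝 0) := by
    refine tendsto_inv_atTop_zero.comp ?_
    have e : (fun n => l n - K) = fun n : ℕ => (n : ℝ) + (K + 1) := by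
      ext n; simp only [hl]; ring
    rw [e]
    exact tendsto_atTop_add_const_right _ _ tendsto_natCast_atTop_atTop
  have hconvD : ∀ z w, A z w → Tendsto (fun n => l n • J n z - z) atTop (𝓝 0) := by
    intro z w hzw
    have e : ∀ n, l n • J n z - z = J n w := by
      intro n
      have h1 : A z (l n • z - (l n • z - w)) := by rwa [sub_sub_cancel]
      have h2 := hA.eq_of_graph (hlK n) h1 (hJ n _)
      rw [map_sub, map_smul] at h2
      nth_rewrite 2 [h2]
      abel
    simp only [e]
    refine squeeze_zero_norm (fun n => hJb n w) ?_
    simpa using hltop.mul_const ‖w‖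
  have hconv : ∀ z, Tendsto (fun n => l n • J n z) atTop (𝓝 z) := by
    intro z
    rw [Metric.tendsto_atTop]
    intro ε hε
    obtain ⟨z', hz', w, hw⟩ := Metric.dense_iff.1 hA.dense_domain z (ε / 6) (by positivity)
    obtain ⟨N, hN⟩ := Metric.tendsto_atTop.1 (hconvD z' w hw) (ε / 2) (by positivity)
    refine ⟨N, fun n hn => ?_⟩
    have h1 := hN n hn
    rw [Metric.mem_ball, dist_eq_norm] at hz'
    rw [dist_zero_right] at h1
    have h2 := hlJ n (z' - z)
    have e : l n • J n z - z = (l n • J n z' - z') - l n • J n (z' - z) + (z' - z) := by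
      rw [map_sub, smul_sub]; abel
    rw [dist_eq_norm, e]
    have h3 := norm_add_le ((l n • J n z' - z') - l n • J n (z' - z)) (z' - z)
    have h4 := norm_sub_le (l n • J n z' - z') (l n • J n (z' - z))
    linarith
  -- This operator is `l A J`, because `A (J x) = l J x - x`. On the domain it equals `l J A`, which
  -- converges to `A` since `l J → 1` strongly.
  refine ⟨fun n => (l n) ^ 2 • J n - l n • 1, fun n m => ?_, fun n x => ?_, fun x y hxy => ?_⟩
  · have c1 := ((hcomm n m).smul_left (l n ^ 2)).smul_right (l m ^ 2)
    have c2 : Commute (l n ^ 2 • J n) (l m • (1 : X →L[ℝ] X)) := (Commute.one_right _).smul_right _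
    have c3 : ∀ B : X →L[ℝ] X, Commute (l n • (1 : X →L[ℝ] X)) B := fun B =>
      (Commute.one_left _).smul_left _
    exact (c1.sub_right c2).sub_left ((c3 _))
  · have h1 := hA.dissipative (hJ n x)
    set w := l n • J n x - x with hw
    have hx : x = l n • J n x - w := by rw [hw]; abel
    have hY : (l n ^ 2 • J n - l n • (1 : X →L[ℝ] X)) x = l n • w := by
      simp [hw, smul_sub, smul_smul, pow_two]
    -- Here `w = A (J x)`, so dissipativity bounds the first term by `K ‖l J x‖²`, at most `4 K
    -- ‖x‖²`.
    have e : inner ℝ (l n • w) x = l n ^ 2 * inner ℝ w (J n x) - l n * ‖w‖ ^ 2 := by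
      conv_lhs => rw [hx]
      rw [inner_sub_right, inner_smul_left, inner_smul_left, inner_smul_right,
        real_inner_self_eq_norm_sq]
      simp only [conj_trivial]
      ring
    have h2 := hlJ n x
    rw [norm_smul, Real.norm_of_nonneg (hl0 n).le] at h2
    have h3 : (l n * ‖J n x‖) ^ 2 ≤ (2 * ‖x‖) ^ 2 :=
      pow_le_pow_left₀ (mul_nonneg (hl0 n).le (norm_nonneg _)) h2 2
    rw [hY, e]
    have h4 : l n ^ 2 * inner ℝ w (J n x) ≤ l n ^ 2 * (K * ‖J n x‖ ^ 2) :=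
      mul_le_mul_of_nonneg_left h1 (sq_nonneg _)
    have h5 : K * (l n * ‖J n x‖) ^ 2 ≤ K * (2 * ‖x‖) ^ 2 := mul_le_mul_of_nonneg_left h3 hK
    have h6 : 0 ≤ l n * ‖w‖ ^ 2 := mul_nonneg (hl0 n).le (sq_nonneg _)
    linarith [show l n ^ 2 * (K * ‖J n x‖ ^ 2) = K * (l n * ‖J n x‖) ^ 2 by ring,
      show K * (2 * ‖x‖) ^ 2 = 4 * K * ‖x‖ ^ 2 by ring]
  · refine (hconv y).congr fun n => ?_
    have h1 : A x (l n • x - (l n • x - y)) := by rwa [sub_sub_cancel]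
    have h2 := hA.eq_of_graph (hlK n) h1 (hJ n _)
    rw [map_sub, map_smul] at h2
    have h3 : J n y = l n • J n x - x := by
      nth_rewrite 2 [h2]
      abel
    rw [h3]
    simp [smul_sub, smul_smul, pow_two]

/-- On the dense set the difference of two exponentials is controlled by `‖Y m x - Y n x‖`; the
uniform growth bound extends this to all of `X`. -/
theorem uniformCauchySeqOn_exp {Y : ℕ → X →L[ℝ] X} {κ : ℝ} (hκ : 0 ≤ κ)
    (hc : ∀ n m, Commute (Y n) (Y m)) (hY : ∀ n x, inner ℝ (Y n x) x ≤ κ * ‖x‖ ^ 2)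
    {D : Set X} (hD : Dense D) (hlim : ∀ x ∈ D, CauchySeq fun n => Y n x) (x : X) {T : ℝ}
    (hT : 0 ≤ T) :
    UniformCauchySeqOn (fun n t => NormedSpace.exp (t • Y n) x) atTop (Icc 0 T) := by
  rw [Metric.uniformCauchySeqOn_iff]
  intro ε hε
  set M := Real.exp (κ * T) with hM
  have hM0 : 0 < M := Real.exp_pos _
  have hMt : ∀ t ∈ Icc 0 T, Real.exp (κ * t) ≤ M := fun t ht =>
    Real.exp_le_exp.2 (mul_le_mul_of_nonneg_left ht.2 hκ)
  obtain ⟨x', hx', hxD⟩ := Metric.dense_iff.1 hD x (ε / (4 * M)) (by positivity)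
  rw [Metric.mem_ball, dist_comm, dist_eq_norm] at hx'
  obtain ⟨N, hN⟩ := Metric.cauchySeq_iff.1 (hlim x' hxD) (ε / (2 * (T + 1) * M)) (by positivity)
  refine ⟨N, fun m hm n hn t ht => ?_⟩
  have hb : ∀ k, ‖NormedSpace.exp (t • Y k) (x - x')‖ ≤ ε / 4 := by
    intro k
    refine (norm_exp_smul_apply_le (hY k) ht.1 _).trans ?_
    calc Real.exp (κ * t) * ‖x - x'‖ ≤ M * (ε / (4 * M)) := by
          have := hMt t ht
          gcongr
      _ = ε / 4 := by field_simp
  have h2 := norm_exp_sub_exp_le (hc m n) (hY m) (hY n) ht.1 x'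
  have h3 : t * Real.exp (κ * t) * ‖Y m x' - Y n x'‖ < ε / 2 := by
    have h4 := hN m hm n hn
    rw [dist_eq_norm] at h4
    calc t * Real.exp (κ * t) * ‖Y m x' - Y n x'‖ ≤ T * M * ‖Y m x' - Y n x'‖ := by
          have := hMt t ht
          have := ht.2
          gcongr
      _ ≤ T * M * (ε / (2 * (T + 1) * M)) := by gcongr
      _ < (T + 1) * M * (ε / (2 * (T + 1) * M)) := by gcongr; linarith
      _ = ε / 2 := by field_simp
  have e : NormedSpace.exp (t • Y m) x - NormedSpace.exp (t • Y n) x =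
      NormedSpace.exp (t • Y m) (x - x') - NormedSpace.exp (t • Y n) (x - x') +
        (NormedSpace.exp (t • Y m) x' - NormedSpace.exp (t • Y n) x') := by
    rw [map_sub, map_sub]; abel
  rw [dist_eq_norm, e]
  have h5 := norm_add_le (NormedSpace.exp (t • Y m) (x - x') - NormedSpace.exp (t • Y n) (x - x'))
    (NormedSpace.exp (t • Y m) x' - NormedSpace.exp (t • Y n) x')
  have h6 := norm_sub_le (NormedSpace.exp (t • Y m) (x - x')) (NormedSpace.exp (t • Y n) (x - x'))
  linarith [hb m, hb n]

end IsMaximalDissipative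

theorem tendsto_slope_zero_of_hasDerivWithinAt {X : Type*} [NormedAddCommGroup X]
    [NormedSpace ℝ X] {F : ℝ → X} {y : X} (h : HasDerivWithinAt F y (Ioi 0) 0) :
    Tendsto (fun t : ℝ => t⁻¹ • (F t - F 0)) (𝓝[>] 0) (𝓝 y) := by
  have := (hasDerivWithinAt_iff_tendsto_slope' (by simp)).1 h
  refine this.congr fun t => ?_
  rw [slope_def_module, sub_zero]

namespace IsMaximalDissipative

variable {X : Type*} [NormedAddCommGroup X] [InnerProductSpace ℝ X] [CompleteSpace X]
  {A : X → X → Prop} {K : ℝ}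

/-- Maximal dissipative operators generate strongly continuous semigroups. -/
theorem exists_semigroup (hA : IsMaximalDissipative A K) (hK : 0 ≤ K) :
    ∃ S : ℝ → X →L[ℝ] X, IsSemigroupGeneratedBy S A := by
  obtain ⟨Y, hc, hY, hlim⟩ := hA.exists_yosida hK
  set κ := 4 * K with hκdef
  have hκ : 0 ≤ κ := by positivity
  have hcau := fun (x : X) {T : ℝ} (hT : 0 ≤ T) => uniformCauchySeqOn_exp hκ hc hY hA.dense_domain
    (fun x ⟨y, hxy⟩ => (hlim x y hxy).cauchySeq) x hT
  set E : ℕ → ℝ → X →L[ℝ] X := fun n t => NormedSpace.exp (t • Y n) with hE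
  have hEb : ∀ n t x, 0 ≤ t → ‖E n t x‖ ≤ Real.exp (κ * t) * ‖x‖ := fun n t x ht =>
    norm_exp_smul_apply_le (hY n) ht x
  -- Convergence is known only for nonnegative times; `max t 0` merely makes the limit total.
  have hex : ∀ (t : ℝ) (x : X), ∃ y, Tendsto (fun n => E n (max t 0) x) atTop (𝓝 y) := by
    intro t x
    have h := (hcau x (le_max_right t 0)).cauchySeq (x := max t 0) ⟨le_max_right _ _, le_rfl⟩
    exact cauchySeq_tendsto_of_complete h
  choose s hs using hex
  have hsb : ∀ t x, ‖s t x‖ ≤ Real.exp (κ * max t 0) * ‖x‖ := fun t x =>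
    le_of_tendsto' (hs t x).norm fun n => hEb n _ x (le_max_right _ _)
  let S' : ℝ → X →ₗ[ℝ] X := fun t =>
    { toFun := s t
      map_add' := fun x y => tendsto_nhds_unique (hs t (x + y)) (by
        simpa only [map_add] using (hs t x).add (hs t y))
      map_smul' := fun c x => tendsto_nhds_unique (hs t (c • x)) (by
        simpa only [map_smul, RingHom.id_apply] using (hs t x).const_smul c) }
  let S : ℝ → X →L[ℝ] X := fun t => (S' t).mkContinuous _ (hsb t)
  have hS : ∀ t x, 0 ≤ t → Tendsto (fun n => E n t x) atTop (𝓝 (S t x)) := by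
    intro t x ht
    have := hs t x
    rwa [max_eq_left ht] at this
  have hSb : ∀ t x, 0 ≤ t → ‖S t x‖ ≤ Real.exp (κ * t) * ‖x‖ := fun t x ht =>
    le_of_tendsto' (hS t x ht).norm fun n => hEb n t x ht
  have hEc : ∀ n x, Continuous fun t => E n t x := fun n x =>
    continuous_iff_continuousAt.2 fun t => (hasDerivAt_exp_apply (Y n) x t).continuousAt
  have hcontT : ∀ x T, 0 ≤ T → ContinuousOn (fun t => S t x) (Icc 0 T) := by
    intro x T hT
    exact ((hcau x hT).tendstoUniformlyOn_of_tendsto fun t ht => hS t x ht.1).continuousOn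
      (Eventually.of_forall fun n => (hEc n x).continuousOn).frequently
  have hcont : ∀ x, ContinuousOn (fun t => S t x) (Ici 0) := by
    intro x t ht
    have h1 := hcontT x (t + 1) (by linarith [mem_Ici.1 ht]) t ⟨ht, by linarith⟩
    refine h1.mono_of_mem_nhdsWithin ?_
    filter_upwards [self_mem_nhdsWithin, nhdsWithin_le_nhds (Iio_mem_nhds (lt_add_one t))] with r h h'
    exact ⟨h, h'.le⟩
  have hS0 : S 0 = ContinuousLinearMap.id ℝ X := by
    ext x
    refine tendsto_nhds_unique (hS 0 x le_rfl) ?_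
    simp [hE]
  have hadd : ∀ a b : ℝ, 0 ≤ a → 0 ≤ b → S (a + b) = (S a).comp (S b) := by
    intro a b ha hb
    ext x
    refine tendsto_nhds_unique (hS (a + b) x (add_nonneg ha hb)) ?_
    have e : ∀ n, E n (a + b) x = E n a (S b x) + E n a (E n b x - S b x) := by
      intro n
      let _ : NormedAlgebra ℚ (X →L[ℝ] X) := NormedAlgebra.restrictScalars ℚ ℝ _
      have : E n (a + b) = E n a * E n b := by
        simp only [hE]
        rw [add_smul, NormedSpace.exp_add_of_commute]
        exact ((Commute.refl (Y n)).smul_left a).smul_right b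
      rw [this, mul_apply_eq_comp, map_sub]
      abel
    simp only [e]
    have h1 : Tendsto (fun n => E n a (E n b x - S b x)) atTop (𝓝 0) := by
      refine squeeze_zero_norm (fun n => hEb n a _ ha) ?_
      have := (tendsto_iff_norm_sub_tendsto_zero.1 (hS b x hb)).const_mul (Real.exp (κ * a))
      rwa [mul_zero] at this
    simpa using (hS a (S b x) ha).add h1
  have hgen : ∀ x y, A x y → Tendsto (fun h : ℝ => h⁻¹ • (S h x - x)) (𝓝[>] 0) (𝓝 y) := by
    intro x y hxy
    -- The integrated equation passes to the limit by dominated convergence, and then yields the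
    -- derivative at `0`.
    have hint : ∀ t, 0 ≤ t → S t x = x + ∫ r in (0 : ℝ)..t, S r y := by
      intro t ht
      have e : ∀ n, E n t x = x + ∫ r in (0 : ℝ)..t, E n r (Y n x) := by
        intro n
        have hd : ∀ r, HasDerivAt (fun r => E n r x) (E n r (Y n x)) r := by
          intro r
          have := (hasDerivAt_exp_smul_const (𝕂 := ℝ) (Y n) r).clm_apply (hasDerivAt_const r x)
          simpa using this
        rw [intervalIntegral.integral_eq_sub_of_hasDerivAt (fun r _ => hd r)
          ((hEc n _).intervalIntegrable _ _)]
        simp [hE]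
      refine tendsto_nhds_unique (hS t x ht) ?_
      simp only [e]
      refine Tendsto.const_add x ?_
      obtain ⟨B, hB⟩ := (hlim x y hxy).norm.bddAbove_range
      refine intervalIntegral.tendsto_integral_filter_of_dominated_convergence
        (fun _ => Real.exp (κ * t) * B) (Eventually.of_forall fun n =>
          (hEc n _).aestronglyMeasurable) (Eventually.of_forall fun n =>
          Eventually.of_forall fun r hr => ?_) (by simp) (Eventually.of_forall fun r hr => ?_)
      · rw [uIoc_of_le ht] at hr
        refine (hEb n r _ hr.1.le).trans ?_
        have h1 : ‖Y n x‖ ≤ B := hB ⟨n, rfl⟩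
        have h2 : Real.exp (κ * r) ≤ Real.exp (κ * t) :=
          Real.exp_le_exp.2 (mul_le_mul_of_nonneg_left hr.2 hκ)
        exact mul_le_mul h2 h1 (norm_nonneg _) (Real.exp_pos _).le
      · rw [uIoc_of_le ht] at hr
        have h1 : Tendsto (fun n => E n r (Y n x - y)) atTop (𝓝 0) := by
          refine squeeze_zero_norm (fun n => hEb n r _ hr.1.le) ?_
          have := (tendsto_iff_norm_sub_tendsto_zero.1 (hlim x y hxy)).const_mul
            (Real.exp (κ * r))
          rwa [mul_zero] at this
        have h2 := (hS r y hr.1.le).add h1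
        simp only [← map_add, add_sub_cancel, add_zero] at h2
        exact h2
    have hd : HasDerivWithinAt (fun t => ∫ r in (0 : ℝ)..t, S r y) (S 0 y) (Ioi 0) 0 := by
      refine (intervalIntegral.integral_hasDerivWithinAt_right (s := Ici 0) (t := Ioi 0) (by simp)
        ?_ ?_).mono Ioi_subset_Ici_self
      · refine ⟨Ioi 0, self_mem_nhdsWithin, ?_⟩
        exact ((hcont y).mono Ioi_subset_Ici_self).aestronglyMeasurable measurableSet_Ioi
      · exact (hcont y 0 (mem_Ici.2 le_rfl)).mono Ioi_subset_Ici_self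
    have h1 := tendsto_slope_zero_of_hasDerivWithinAt hd
    rw [hS0] at h1
    refine h1.congr' ?_
    filter_upwards [self_mem_nhdsWithin] with t ht
    rw [hint t (le_of_lt ht)]
    simp
  refine ⟨S, ⟨hS0, hadd, hcont⟩, fun x y => ⟨hgen x y, fun hxy => ?_⟩⟩
  -- The generator is no larger than `A`: `u - x` has right derivative `(κ + 1)(u - x)` at time `0`,
  -- while the growth bound `exp(κ h)` allows a pairing of at most `κ ‖u - x‖²`. Hence `u = x`.
  obtain ⟨u, hu⟩ := hA.range (κ + 1) (by linarith) ((κ + 1) • x - y)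
  have hw : Tendsto (fun h : ℝ => h⁻¹ • (S h (u - x) - (u - x))) (𝓝[>] 0)
      (𝓝 ((κ + 1) • (u - x))) := by
    have h1 := (hgen _ _ hu).sub hxy
    have e : (κ + 1) • u - ((κ + 1) • x - y) - y = (κ + 1) • (u - x) := by
      rw [smul_sub]; abel
    rw [e] at h1
    refine h1.congr fun h => ?_
    rw [← smul_sub, map_sub]
    congr 1
    abel
  have hle : inner ℝ ((κ + 1) • (u - x)) (u - x) ≤ κ * ‖u - x‖ ^ 2 := by
    have h1 : Tendsto (fun h : ℝ => inner ℝ (h⁻¹ • (S h (u - x) - (u - x))) (u - x)) (𝓝[>] 0)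
        (𝓝 (inner ℝ ((κ + 1) • (u - x)) (u - x))) := hw.inner tendsto_const_nhds
    have h2 : Tendsto (fun h : ℝ => h⁻¹ • (Real.exp (κ * h) - Real.exp (κ * 0)) * ‖u - x‖ ^ 2)
        (𝓝[>] 0) (𝓝 (κ * ‖u - x‖ ^ 2)) := by
      have hd : HasDerivAt (fun h : ℝ => Real.exp (κ * h)) κ 0 := by
        have := ((hasDerivAt_id (0 : ℝ)).const_mul κ).exp
        simpa using this
      exact (tendsto_slope_zero_of_hasDerivWithinAt hd.hasDerivWithinAt).mul_const _
    refine le_of_tendsto_of_tendsto h1 h2 ?_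
    filter_upwards [self_mem_nhdsWithin] with h hh
    have hh' : (0 : ℝ) < h := hh
    rw [inner_smul_left, inner_sub_left, real_inner_self_eq_norm_sq]
    simp only [conj_trivial, mul_zero, Real.exp_zero, smul_eq_mul]
    rw [mul_assoc]
    refine mul_le_mul_of_nonneg_left ?_ (inv_nonneg.2 hh'.le)
    have h3 := real_inner_le_norm (S h (u - x)) (u - x)
    have h4 := mul_le_mul_of_nonneg_right (hSb h (u - x) hh'.le) (norm_nonneg (u - x))
    linarith [show Real.exp (κ * h) * ‖u - x‖ * ‖u - x‖ = Real.exp (κ * h) * ‖u - x‖ ^ 2 by ring]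
  rw [inner_smul_left, real_inner_self_eq_norm_sq] at hle
  simp only [conj_trivial] at hle
  have h0 : ‖u - x‖ ^ 2 = 0 := le_antisymm (by linarith) (sq_nonneg _)
  have h1 : u = x := sub_eq_zero.1 (norm_eq_zero.1 (by simpa using h0))
  rw [h1] at hu
  simpa using hu

end IsMaximalDissipative

/-! ### Smoothing -/

namespace IsSemigroupGeneratedBy

variable {X : Type*} [NormedAddCommGroup X] [NormedSpace ℝ X] {A : X → X → Prop}
  {S : ℝ → X →L[ℝ] X}

theorem graph_apply (hS : IsSemigroupGeneratedBy S A) {x y : X} (h : A x y) {t : ℝ} (ht : 0 ≤ t) :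
    A (S t x) (S t y) := by
  rw [hS.2]
  have h1 := ((S t).continuous.tendsto y).comp ((hS.2 x y).1 h)
  refine h1.congr' ?_
  filter_upwards [self_mem_nhdsWithin] with r hr
  have hr' : (0 : ℝ) ≤ r := le_of_lt hr
  have e : S r (S t x) = S t (S r x) := by
    rw [← ContinuousLinearMap.comp_apply, ← ContinuousLinearMap.comp_apply, ← hS.1.add r t hr' ht,
      ← hS.1.add t r ht hr', add_comm]
  simp only [Function.comp_apply, map_smul, map_sub, e]

theorem hasDerivWithinAt (hS : IsSemigroupGeneratedBy S A) {x y : X} (h : A x y) {t : ℝ}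
    (ht : 0 ≤ t) : HasDerivWithinAt (fun t => S t x) (S t y) (Ioi t) t := by
  rw [hasDerivWithinAt_iff_tendsto_slope' (by simp)]
  have h1 := (hS.2 _ _).1 (hS.graph_apply h ht)
  have h2 : Tendsto (fun r : ℝ => r - t) (𝓝[>] t) (𝓝[>] 0) := by
    refine tendsto_nhdsWithin_iff.2 ⟨?_, ?_⟩
    · have : Tendsto (fun r : ℝ => r - t) (𝓝 t) (𝓝 (t - t)) :=
        (continuous_id.sub continuous_const).tendsto t
      rw [sub_self] at this
      exact this.mono_left nhdsWithin_le_nhds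
    · filter_upwards [self_mem_nhdsWithin] with r hr
      exact sub_pos.2 (mem_Ioi.1 hr)
  refine (h1.comp h2).congr' ?_
  filter_upwards [self_mem_nhdsWithin] with r hr
  have hr' : 0 ≤ r - t := sub_nonneg.2 (le_of_lt hr)
  rw [slope_def_module, Function.comp_apply, ← ContinuousLinearMap.comp_apply (S (r - t)),
    ← hS.1.add _ _ hr' ht, sub_add_cancel]

end IsSemigroupGeneratedBy

theorem memLp_two_of_continuousOn {V : Type*} [NormedAddCommGroup V] [NormedSpace ℝ V] {T B : ℝ}
    (hT : 0 ≤ T) (hB : 0 ≤ B) {v : ℝ → V} (hv : ContinuousOn v (Icc 0 T))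
    (hvB : ∫ t in (0 : ℝ)..T, ‖v t‖ ^ 2 ≤ B ^ 2) :
    MemLp v 2 (volume.restrict (Ioo 0 T)) ∧
      eLpNorm v 2 (volume.restrict (Ioo 0 T)) ≤ ENNReal.ofReal B := by
  have hm : MemLp v 2 (volume.restrict (Ioo 0 T)) := by
    obtain ⟨C, hC⟩ := isCompact_Icc.exists_bound_of_continuousOn hv
    refine MemLp.of_bound ((hv.mono Ioo_subset_Icc_self).aestronglyMeasurable measurableSet_Ioo) C ?_
    filter_upwards [ae_restrict_mem measurableSet_Ioo] with x hx
    exact hC x (Ioo_subset_Icc_self hx)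
  refine ⟨hm, ?_⟩
  rw [hm.eLpNorm_eq_integral_rpow_norm (by norm_num) (by norm_num)]
  refine ENNReal.ofReal_le_ofReal ?_
  rw [intervalIntegral.integral_of_le hT, integral_Ioc_eq_integral_Ioo] at hvB
  have h2 : (2 : ℝ≥0∞).toReal = 2 := by simp
  simp only [h2, Real.rpow_ofNat]
  rw [← one_div, ← Real.sqrt_eq_rpow]
  exact Real.sqrt_le_iff.2 ⟨hB, hvB⟩

section Smoothing

variable {X : Type*} [NormedAddCommGroup X] [InnerProductSpace ℝ X]
  {V : Type*} [NormedAddCommGroup V] [NormedSpace ℝ V] {A : X → X → Prop} {K c : ℝ}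
  {S : ℝ → X →L[ℝ] X} {ι : V →L[ℝ] X}

/-- An orbit starting in the domain stays there, so it lies in `V`. The energy inequality for
differences bounds the `V` norm of an increment by `X` increments of `S t x` and `S t y`, which
gives continuity in `V`. -/
theorem exists_lift (hA : IsMaximalDissipative A K) (hc : 0 < c) (hι : Function.Injective ι)
    (hE : ∀ x y, A x y → ∃ v, ι v = x ∧ inner ℝ y x + c * ‖v‖ ^ 2 ≤ K * ‖x‖ ^ 2)
    (hS : IsSemigroupGeneratedBy S A) {x y : X} (h : A x y) :
    ∃ v : ℝ → V, ContinuousOn v (Ici 0) ∧ ∀ t, 0 ≤ t → ι (v t) = S t x := by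
  have hex : ∀ t : ℝ, ∃ v : V, 0 ≤ t → ι v = S t x := by
    intro t
    by_cases ht : 0 ≤ t
    · obtain ⟨v, hv, -⟩ := hE _ _ (hS.graph_apply h ht)
      exact ⟨v, fun _ => hv⟩
    · exact ⟨0, fun h => absurd h ht⟩
  choose v hv using hex
  refine ⟨v, fun s hs => ?_, hv⟩
  have hs' : (0 : ℝ) ≤ s := hs
  set F : ℝ → ℝ := fun t => c⁻¹ * (K * ‖S t x - S s x‖ ^ 2 -
    inner ℝ (S t y - S s y) (S t x - S s x)) with hF
  have hb : ∀ t, 0 ≤ t → ‖v t - v s‖ ≤ Real.sqrt (F t) := by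
    intro t ht
    obtain ⟨w, hw, hw'⟩ := hE _ _ (hA.sub (hS.graph_apply h ht) (hS.graph_apply h hs'))
    have e : w = v t - v s := hι (by rw [hw, map_sub, hv t ht, hv s hs'])
    rw [e] at hw'
    refine Real.le_sqrt_of_sq_le ?_
    simp only [hF]
    rw [inv_mul_eq_div, le_div_iff₀ hc]
    linarith
  have hFc : ContinuousWithinAt (fun t => Real.sqrt (F t)) (Ici 0) s := by
    have h1 := (hS.1.continuousOn x s hs).sub (continuousWithinAt_const (b := S s x))
    have h2 := (hS.1.continuousOn y s hs).sub (continuousWithinAt_const (b := S s y))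
    exact (continuousWithinAt_const.mul ((continuousWithinAt_const.mul (h1.norm.pow 2)).sub
      (h2.inner h1))).sqrt
  have hF0 : Real.sqrt (F s) = 0 := by simp [hF]
  have hlim : Tendsto (fun t => Real.sqrt (F t)) (𝓝[Ici 0] s) (𝓝 0) := by
    have := hFc.tendsto
    rwa [hF0] at this
  refine tendsto_iff_norm_sub_tendsto_zero.2 (squeeze_zero' (Eventually.of_forall fun t =>
    norm_nonneg _) ?_ hlim)
  filter_upwards [self_mem_nhdsWithin] with t ht using hb t ht

/-- The integrated energy inequality. -/
theorem norm_sq_add_integral_le (hK : 0 ≤ K) (hc : 0 < c) (hι : Function.Injective ι)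
    (hE : ∀ x y, A x y → ∃ v, ι v = x ∧ inner ℝ y x + c * ‖v‖ ^ 2 ≤ K * ‖x‖ ^ 2)
    (hS : IsSemigroupGeneratedBy S A) {x y : X} (h : A x y) {v : ℝ → V}
    (hv : ContinuousOn v (Ici 0)) (hvS : ∀ t, 0 ≤ t → ι (v t) = S t x) {T : ℝ} (hT : 0 ≤ T) :
    ‖S T x‖ ^ 2 + 2 * c * ∫ t in (0 : ℝ)..T, ‖v t‖ ^ 2 ≤ Real.exp (2 * K * T) * ‖x‖ ^ 2 := by
  have hsub : Icc 0 T ⊆ Ici 0 := Icc_subset_Ici_self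
  have cx := (hS.1.continuousOn x).mono hsub
  have cy := (hS.1.continuousOn y).mono hsub
  have cexp : ContinuousOn (fun t : ℝ => Real.exp (-(2 * K) * t)) (Icc 0 T) := by fun_prop
  have hφ : ContinuousOn (fun t => Real.exp (-(2 * K) * t) * ‖S t x‖ ^ 2) (Icc 0 T) :=
    cexp.mul (cx.norm.pow 2)
  have hφ' : ContinuousOn (fun t => Real.exp (-(2 * K) * t) *
      (2 * inner ℝ (S t x) (S t y) - 2 * K * ‖S t x‖ ^ 2)) (Icc 0 T) :=
    cexp.mul ((continuousOn_const.mul (cx.inner cy)).sub (continuousOn_const.mul (cx.norm.pow 2)))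
  have hφ'i := hφ'.intervalIntegrable_of_Icc hT (μ := volume)
  have hvi : IntervalIntegrable (fun t => -(2 * c * Real.exp (-(2 * K) * T)) * ‖v t‖ ^ 2)
      volume 0 T :=
    (continuousOn_const.mul ((hv.mono hsub).norm.pow 2)).intervalIntegrable_of_Icc hT
  -- The generator supplies right derivatives only, so a one-sided fundamental theorem is applied to
  -- `exp(-2Kt) ‖S t x‖²`.
  have hftc := intervalIntegral.integral_eq_sub_of_hasDeriv_right_of_le hT hφ
    (f' := fun t => Real.exp (-(2 * K) * t) *
      (2 * inner ℝ (S t x) (S t y) - 2 * K * ‖S t x‖ ^ 2)) (fun t ht => by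
      have h1 := (hS.hasDerivWithinAt h ht.1.le).norm_sq
      have h2 := (((hasDerivAt_id t).const_mul (-(2 * K))).exp).hasDerivWithinAt (s := Ioi t)
      refine (h2.fun_mul h1).congr_deriv ?_
      simp only [id]
      ring) hφ'i
  have hmono := intervalIntegral.integral_mono_on hT hφ'i hvi fun t ht => by
    obtain ⟨w, hw, hw'⟩ := hE _ _ (hS.graph_apply h ht.1)
    have e : w = v t := hι (by rw [hw, hvS t ht.1])
    rw [e, real_inner_comm] at hw'
    have h1 : Real.exp (-(2 * K) * T) ≤ Real.exp (-(2 * K) * t) :=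
      Real.exp_le_exp.2 (mul_le_mul_of_nonpos_left ht.2 (by linarith))
    have h2 : 2 * inner ℝ (S t x) (S t y) - 2 * K * ‖S t x‖ ^ 2 ≤ -(2 * c * ‖v t‖ ^ 2) := by
      linarith
    have h3 := mul_le_mul_of_nonneg_left h2 (Real.exp_pos (-(2 * K) * t)).le
    have h4 : Real.exp (-(2 * K) * T) * (2 * c * ‖v t‖ ^ 2) ≤
        Real.exp (-(2 * K) * t) * (2 * c * ‖v t‖ ^ 2) :=
      mul_le_mul_of_nonneg_right h1 (by positivity)
    linarith
  rw [hftc, intervalIntegral.integral_const_mul, hS.1.zero] at hmono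
  simp only [mul_zero, Real.exp_zero, one_mul, ContinuousLinearMap.id_apply] at hmono
  have h5 : Real.exp (2 * K * T) * Real.exp (-(2 * K) * T) = 1 := by
    rw [← Real.exp_add]; simp
  have h6 := mul_le_mul_of_nonneg_left hmono (Real.exp_pos (2 * K * T)).le
  have e1 : Real.exp (2 * K * T) * (Real.exp (-(2 * K) * T) * ‖S T x‖ ^ 2 - ‖x‖ ^ 2) =
      (Real.exp (2 * K * T) * Real.exp (-(2 * K) * T)) * ‖S T x‖ ^ 2 -
        Real.exp (2 * K * T) * ‖x‖ ^ 2 := by ring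
  have e2 : Real.exp (2 * K * T) * (-(2 * c * Real.exp (-(2 * K) * T)) *
      ∫ t in (0 : ℝ)..T, ‖v t‖ ^ 2) = -((Real.exp (2 * K * T) * Real.exp (-(2 * K) * T)) *
        (2 * c * ∫ t in (0 : ℝ)..T, ‖v t‖ ^ 2)) := by ring
  rw [e1, e2, h5] at h6
  linarith

/-- The integrated energy inequality on the dense domain, then closedness. It recovers the rate `K`
lost in the construction and applies to any semigroup with this generator. -/
theorem norm_semigroup_le [CompleteSpace X] (hA : IsMaximalDissipative A K) (hK : 0 ≤ K) (hc : 0 < c)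
    (hι : Function.Injective ι)
    (hE : ∀ x y, A x y → ∃ v, ι v = x ∧ inner ℝ y x + c * ‖v‖ ^ 2 ≤ K * ‖x‖ ^ 2)
    (hS : IsSemigroupGeneratedBy S A) {T : ℝ} (hT : 0 ≤ T) (x : X) :
    ‖S T x‖ ≤ Real.exp (K * T) * ‖x‖ := by
  have hcl : IsClosed {x : X | ‖S T x‖ ≤ Real.exp (K * T) * ‖x‖} :=
    isClosed_le (S T).continuous.norm (continuous_const.mul continuous_norm)
  refine hcl.closure_subset_iff.2 ?_ (hA.dense_domain x)
  rintro x ⟨y, h⟩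
  obtain ⟨v, hv, hvS⟩ := exists_lift hA hc hι hE hS h
  have h1 := norm_sq_add_integral_le hK hc hι hE hS h hv hvS hT
  have h2 : 0 ≤ ∫ t in (0 : ℝ)..T, ‖v t‖ ^ 2 :=
    intervalIntegral.integral_nonneg hT fun t _ => sq_nonneg _
  have h3 : 0 ≤ 2 * c * ∫ t in (0 : ℝ)..T, ‖v t‖ ^ 2 := by positivity
  refine (sq_le_sq₀ (norm_nonneg _) (by positivity)).1 ?_
  rw [mul_pow, ← Real.exp_nat_mul]
  push_cast
  rw [← mul_assoc]
  linarith

/-- Approximate `u` from the domain. The energy bound on differences makes the lifts Cauchy in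
`L²(0,T;V)`; an almost everywhere convergent subsequence and the continuity of `ι` identify the
limit with the orbit of `u`. -/
theorem exists_memLp_lift [CompleteSpace X] [CompleteSpace V] (hA : IsMaximalDissipative A K) (hK : 0 ≤ K)
    (hc : 0 < c) (hι : Function.Injective ι)
    (hE : ∀ x y, A x y → ∃ v, ι v = x ∧ inner ℝ y x + c * ‖v‖ ^ 2 ≤ K * ‖x‖ ^ 2)
    (hS : IsSemigroupGeneratedBy S A) {T : ℝ} (hT : 0 ≤ T) (u : X) :
    ∃ v : ℝ → V, MemLp v 2 (volume.restrict (Ioo 0 T)) ∧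
      (∀ᵐ t ∂(volume.restrict (Ioo 0 T)), ι (v t) = S t u) ∧
      eLpNorm v 2 (volume.restrict (Ioo 0 T)) ≤
        ENNReal.ofReal (Real.sqrt (Real.exp (2 * K * T) / (2 * c)) * ‖u‖) := by
  set B := Real.sqrt (Real.exp (2 * K * T) / (2 * c)) with hB
  have hB0 : 0 ≤ B := Real.sqrt_nonneg _
  have hbound : ∀ {x y : X} {v : ℝ → V}, A x y → ContinuousOn v (Ici 0) →
      (∀ t, 0 ≤ t → ι (v t) = S t x) → MemLp v 2 (volume.restrict (Ioo 0 T)) ∧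
        eLpNorm v 2 (volume.restrict (Ioo 0 T)) ≤ ENNReal.ofReal (B * ‖x‖) := by
    intro x y v h hv hvS
    refine memLp_two_of_continuousOn hT (by positivity) (hv.mono Icc_subset_Ici_self) ?_
    have h1 := norm_sq_add_integral_le hK hc hι hE hS h hv hvS hT
    have h2 : 0 ≤ ‖S T x‖ ^ 2 := sq_nonneg _
    rw [mul_pow, hB, Real.sq_sqrt (by positivity), div_mul_eq_mul_div, le_div_iff₀ (by positivity)]
    linarith
  obtain ⟨x, hxD, hx⟩ := mem_closure_iff_seq_limit.1 (hA.dense_domain u)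
  choose y hy using hxD
  choose v hvc hv using fun k => exists_lift hA hc hι hE hS (hy k)
  have hm := fun k => (hbound (hy k) (hvc k) (hv k)).1
  have hdist : ∀ k j, dist (hm k).toLp (hm j).toLp ≤ B * dist (x k) (x j) := by
    intro k j
    have h1 := hbound (v := v k - v j) (hA.sub (hy k) (hy j)) ((hvc k).sub (hvc j))
      (fun t ht => by rw [Pi.sub_apply, map_sub, map_sub, hv k t ht, hv j t ht])
    rw [dist_eq_norm, dist_eq_norm, ← MemLp.toLp_sub, Lp.norm_toLp]
    exact ENNReal.toReal_le_of_le_ofReal (by positivity) h1.2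
  have hcau : CauchySeq fun k => (hm k).toLp := by
    rw [Metric.cauchySeq_iff]
    intro ε hε
    obtain ⟨N, hN⟩ := Metric.cauchySeq_iff.1 hx.cauchySeq (ε / (B + 1)) (by positivity)
    refine ⟨N, fun m hm n hn => (hdist m n).trans_lt ?_⟩
    have h1 := hN m hm n hn
    rw [lt_div_iff₀ (by positivity)] at h1
    nlinarith [dist_nonneg (x := x m) (y := x n)]
  obtain ⟨w, hw⟩ := cauchySeq_tendsto_of_complete hcau
  refine ⟨w, Lp.memLp w, ?_, ?_⟩
  · obtain ⟨ns, hns, hae⟩ := (tendstoInMeasure_of_tendsto_Lp hw).exists_seq_tendsto_ae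
    have hcoe : ∀ᵐ t ∂(volume.restrict (Ioo 0 T)), ∀ k, ((hm k).toLp : ℝ → V) t = v k t :=
      ae_all_iff.2 fun k => (hm k).coeFn_toLp
    filter_upwards [hae, hcoe, ae_restrict_mem measurableSet_Ioo] with t h1 h2 h3
    have h4 := (ι.continuous.tendsto _).comp h1
    have h5 := ((S t).continuous.tendsto u).comp (hx.comp hns.tendsto_atTop)
    refine tendsto_nhds_unique h4 (h5.congr fun i => ?_)
    simp only [Function.comp_apply, h2, hv _ t h3.1.le]
  · rw [← ENNReal.ofReal_toReal (Lp.eLpNorm_ne_top w), ← Lp.norm_def]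
    refine ENNReal.ofReal_le_ofReal (le_of_tendsto_of_tendsto' hw.norm (hx.norm.const_mul B)
      fun k => ?_)
    rw [Lp.norm_toLp]
    exact ENNReal.toReal_le_of_le_ofReal (by positivity) (hbound (hy k) (hvc k) (hv k)).2

end Smoothing

/-! ### The semigroup of the Kawahara operator -/

theorem MemSobolev.add {L : ℝ} {m : ℕ} {u u' : ℝ → ℝ} (h : MemSobolev L m u)
    (h' : MemSobolev L m u') : MemSobolev L m (u + u') := by
  intro k hk
  obtain ⟨v, a, b⟩ := h k hk
  obtain ⟨v', a', b'⟩ := h' k hk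
  exact ⟨v + v', a.add a', b.add b'⟩

theorem MemSobolev.smul {L : ℝ} {m : ℕ} {u : ℝ → ℝ} (c : ℝ) (h : MemSobolev L m u) :
    MemSobolev L m (c • u) := by
  intro k hk
  obtain ⟨v, a, b⟩ := h k hk
  exact ⟨c • v, a.smul c, b.const_smul c⟩

theorem MemSobolev.congr {L : ℝ} {m : ℕ} {u u' : ℝ → ℝ} (h : MemSobolev L m u)
    (hu : u =ᵐ[volume.restrict (Ioo 0 L)] u') : MemSobolev L m u' := by
  intro k hk
  obtain ⟨v, a, b⟩ := h k hk
  exact ⟨v, a.congr hu, b⟩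

theorem coe_add_ae_eq {L : ℝ} (u v : SpaceH L) :
    (u : ℝ → ℝ) + (v : ℝ → ℝ) =ᵐ[volume.restrict (Ioo 0 L)] (u + v : SpaceH L) :=
  ((ae_eq_muH_iff L).1 (Lp.coeFn_add u v)).symm

theorem coe_smul_ae_eq {L : ℝ} (c : ℝ) (u : SpaceH L) :
    c • (u : ℝ → ℝ) =ᵐ[volume.restrict (Ioo 0 L)] (c • u : SpaceH L) :=
  ((ae_eq_muH_iff L).1 (Lp.coeFn_smul c u)).symm

namespace KawaharaGraph

variable {L β : ℝ} {u f u' f' : SpaceH L}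

theorem add (h : KawaharaGraph L β u f) (h' : KawaharaGraph L β u' f') :
    KawaharaGraph L β (u + u') (f + f') := by
  obtain ⟨a1, a2, ⟨u2, a3, a4⟩, u3, u5, a5, a6, a7⟩ := h
  obtain ⟨b1, b2, ⟨v2, b3, b4⟩, v3, v5, b5, b6, b7⟩ := h'
  have e := coe_add_ae_eq u u'
  refine ⟨(a1.add b1).congr e, (a2.add b2).congr e, ⟨_, (a3.add b3).congr e, a4.add b4⟩, _, _,
    (a5.add b5).congr e, (a6.add b6).congr e, ?_⟩
  filter_upwards [coe_add_ae_eq f f', a7, b7] with x h1 h2 h3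
  rw [← h1, Pi.add_apply, h2, h3, Pi.add_apply, Pi.add_apply]
  ring

theorem smul (c : ℝ) (h : KawaharaGraph L β u f) : KawaharaGraph L β (c • u) (c • f) := by
  obtain ⟨a1, a2, ⟨u2, a3, a4⟩, u3, u5, a5, a6, a7⟩ := h
  have e := coe_smul_ae_eq c u
  refine ⟨(a1.smul c).congr e, (a2.smul c).congr e, ⟨_, (a3.smul c).congr e, a4.smul c⟩, _, _,
    (a5.smul c).congr e, (a6.smul c).congr e, ?_⟩
  filter_upwards [coe_smul_ae_eq c f, a7] with x h1 h2
  rw [← h1, Pi.smul_apply, h2, Pi.smul_apply, Pi.smul_apply]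
  simp only [smul_eq_mul]
  ring

theorem unique (h : KawaharaGraph L β u f) (h' : KawaharaGraph L β u f') : f = f' := by
  obtain ⟨-, -, -, u3, u5, a5, a6, a7⟩ := h
  obtain ⟨-, -, -, v3, v5, b5, b6, b7⟩ := h'
  refine Lp.ext ((ae_eq_muH_iff L).2 ?_)
  filter_upwards [a7, b7, a5.unique b5, a6.unique b6] with x h1 h2 h3 h4
  rw [h1, h2, h3, h4]

theorem isMaximalDissipative (hL : 0 < L) (hβ : -(3 / 80 : ℝ) < β) :
    IsMaximalDissipative (KawaharaGraph L β) (1 / 10) where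
  add := add
  smul := fun c _ _ h => h.smul c
  unique := unique
  dissipative := fun h => by
    obtain ⟨v, -, hv⟩ := h.energy hL hβ
    have := sq_nonneg ‖v‖
    linarith
  range := fun _ hl f => exists_kawaharaGraph hL hβ hl f

end KawaharaGraph

/-- Global Kato smoothing for the semigroup generated by `u ↦ u_xxxxx - β u_xxx`
in `H = L²((0, L), dx / (L - x))`. -/
theorem mainTheorem8 (L : ℝ) (hL : 0 < L) :
    (∀ β : ℝ, -(3 / 80 : ℝ) < β →
      ∃ S : ℝ → SpaceH L →L[ℝ] SpaceH L, IsSemigroupGeneratedBy S (KawaharaGraph L β)) ∧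
    ∀ T : ℝ, 0 < T → ∃ C : ℝ, 0 < C ∧
      ∀ β : ℝ, -(3 / 80 : ℝ) < β →
        ∀ S : ℝ → SpaceH L →L[ℝ] SpaceH L, IsSemigroupGeneratedBy S (KawaharaGraph L β) →
          ∀ u₀ : SpaceH L, ∃ v : ℝ → SpaceV L,
            MemLp v 2 (volume.restrict (Ioo 0 T)) ∧
            (∀ᵐ t ∂(volume.restrict (Ioo 0 T)), SpaceV.toH (v t) = S t u₀) ∧
            eLpNorm (fun t => S t u₀) ∞ (volume.restrict (Ioo 0 T)) +
                eLpNorm v 2 (volume.restrict (Ioo 0 T)) ≤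
              ENNReal.ofReal C * ENNReal.ofReal ‖u₀‖ := by
  refine ⟨fun β hβ => (KawaharaGraph.isMaximalDissipative hL hβ).exists_semigroup (by norm_num),
    fun T hT => ?_⟩
  -- The smoothing constant for `K = 1/10` and `c = 1/20`, hence independent of `β`.
  set B := Real.sqrt (Real.exp (2 * (1 / 10) * T) / (2 * (1 / 20)))
  refine ⟨Real.exp (1 / 10 * T) + B, by positivity, fun β hβ S hS u₀ => ?_⟩
  have := SpaceV.completeSpace hL
  obtain ⟨C, hC⟩ := SpaceV.exists_norm_toH_le hL
  let ι : SpaceV L →L[ℝ] SpaceH L := SpaceV.toH.mkContinuous C hC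
  have hι : Function.Injective ι := Subtype.val_injective
  have hA := KawaharaGraph.isMaximalDissipative hL hβ
  have hE : ∀ x y, KawaharaGraph L β x y →
      ∃ v, ι v = x ∧ inner ℝ y x + 1 / 20 * ‖v‖ ^ 2 ≤ 1 / 10 * ‖x‖ ^ 2 :=
    fun x y h => h.energy hL hβ
  have hK : (0 : ℝ) ≤ 1 / 10 := by norm_num
  have hc : (0 : ℝ) < 1 / 20 := by norm_num
  obtain ⟨v, hv, hvS, hvB⟩ := exists_memLp_lift hA hK hc hι hE hS hT.le u₀
  refine ⟨v, hv, hvS, ?_⟩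
  have hsup : eLpNorm (fun t => S t u₀) ∞ (volume.restrict (Ioo 0 T)) ≤
      ENNReal.ofReal (Real.exp (1 / 10 * T) * ‖u₀‖) := by
    rw [eLpNorm_exponent_top]
    refine eLpNormEssSup_le_of_ae_bound ?_
    filter_upwards [ae_restrict_mem measurableSet_Ioo] with t ht
    refine (norm_semigroup_le hA hK hc hι hE hS ht.1.le u₀).trans ?_
    have := ht.2.le
    gcongr
  refine (add_le_add hsup hvB).trans (le_of_eq ?_)
  rw [← ENNReal.ofReal_add (by positivity) (by positivity), ← ENNReal.ofReal_mul (by positivity),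
    add_mul]
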